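/- Let $E$ be a finite set and for each $a\in E$ let $u_a(x)=\frac{p_a}{q_a}x+\frac{r_a}{q_a}$ with $p_a\in\{1,-1\}$, $r_a\in\mathbb{Z}$ and $q_a\geq 2$ a natural number. Assume the strong separation condition: there is a closed interval $[c,d]$, $c<d$, such that the sets $u_a([c,d])$, $a\in E$, are pairwise disjoint subsets of $[c,d]$. Let $\pi:E^{\mathbb{N}}\to\mathbb{R}$, $\pi(\omega)=\lim_{n\to\infty}u_{\omega_1}\circ\cdots\circ u_{\omega_n}(0)$, let $J=\pi(E^{\mathbb{N}})$, let $\delta$ be the Hausdorff dimension of $J$, and let $\mu$ be the $\delta$-dimensional Hausdorff measure restricted to $J$ and normalized to be a probability measure. Every rational number $y\in J$ equals $\pi(\omega)$ for exactly one $\omega\in E^{\mathbb{N}}$, and this $\omega$ is eventually periodic. Let $n\ge 0$ be minimal such that the shifted word $\omega_{n+1}\omega_{n+2}\ldots$ is periodic, and let $m\ge 1$ be its minimal period. The intrinsic denominator of $y$ is $$y_{\mathrm{int}}=\Big(\prod_{i=1}^{n}q_{\omega_i}\Big)\Big(\prod_{i=n+1}^{n+m}q_{\omega_i}-\prod_{i=n+1}^{n+m}p_{\omega_i}\Big).$$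 For $\psi:(0,\infty)\to(0,\infty)$, a point $x\in J$ is badly symbolically approximable with respect to $\psi$ if there is $\varepsilon>0$ such that $|x-y|\geq\varepsilon\,\psi(y_{\mathrm{int}})/y_{\mathrm{int}}$ for all $y\in\mathbb{Q}\cap J$; otherwise $x$ is symbolically well approximable with respect to $\psi$. Theorem (a Khinchin-type theorem for fractals). Let $\psi:(0,\infty)\to(0,\infty)$ be nonincreasing, bounded and slowly varying, i.e. for every $K>0$ there is $C>0$ with $C^{-1}\psi(t)\le\psi(Kt)\le C\psi(t)$ for all $t>0$. (i) If the series $\sum_{q=1}^{\infty}\frac{\log(q)\,\psi(q)^{\delta}}{q}$ converges, then $\mu$-almost every $x\in J$ is badly symbolically approximable with respect to $\psi$. (ii) If the series $\sum_{q=1}^{\infty}\frac{\log(q)\,\psi(q)^{\delta}}{q\,\log(\psi(q))}$ (where undefined terms, those with $\psi(q)=1$, are omitted) diverges, then $\mu$-almost every $x\in J$ is symbolically well approximable with respect to $\psi$. -/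

import Mathlib

open Filter Topology MeasureTheory Set

/-- The data of a rational system of contracting similarities of the real line indexed by `E`:
`u_a(x) = (p_a / q_a) x + r_a / q_a` with integers `p_a`, `r_a` and a natural number `q_a`;
the ratio `p_a / q_a` is nonzero (similarity) and of modulus less than one (contraction). -/
structure RationalIFS (E : Type*) where
  p : E → ℤ
  q : E → ℕ
  r : E → ℤ
  p_ne_zero : ∀ a, p a ≠ 0
  abs_p_lt : ∀ a, |p a| < (q a : ℤ)

namespace RationalIFS

variable {E : Type*}

/-- The similarity `u_a`. -/
noncomputable def u (S : RationalIFS E) (a : E) (x : ℝ) : ℝ :=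
  (S.p a : ℝ) / (S.q a : ℝ) * x + (S.r a : ℝ) / (S.q a : ℝ)

/-- The composition `u_{ω_0} ∘ ⋯ ∘ u_{ω_{n-1}}`. -/
noncomputable def prefixMap (S : RationalIFS E) (ω : ℕ → E) : ℕ → ℝ → ℝ
  | 0 => id
  | n + 1 => S.prefixMap ω n ∘ S.u (ω n)

/-- The coding map `π(ω) = lim_n u_{ω_0} ∘ ⋯ ∘ u_{ω_{n-1}} (0)`; the limit exists when `E` is
finite, see `tendsto_coding`. -/
noncomputable def coding (S : RationalIFS E) (ω : ℕ → E) : ℝ :=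
  limUnder atTop (fun n => S.prefixMap ω n 0)

/-- The limit set `J`, the image of the coding map. -/
def limitSet (S : RationalIFS E) : Set ℝ := range S.coding

/-- The Hausdorff dimension `δ` of the limit set (a subset of the line, so `δ ≤ 1`). -/
noncomputable def dim (S : RationalIFS E) : ℝ := (dimH S.limitSet).toReal

/-- The `δ`-dimensional Hausdorff measure restricted to the limit set and normalized. -/
noncomputable def measure (S : RationalIFS E) : Measure ℝ :=
  (Measure.hausdorffMeasure S.dim S.limitSet)⁻¹ •
    (Measure.hausdorffMeasure S.dim).restrict S.limitSet

/-- The strong separation condition: for some (nondegenerate) closed interval `[c, d]`, the images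
`u_a([c, d])` are pairwise disjoint subsets of `[c, d]`. It implies the open set condition,
with the open set `(c, d)`. -/
def StrongSeparation (S : RationalIFS E) : Prop :=
  ∃ c d : ℝ, c < d ∧ (∀ a, S.u a '' Icc c d ⊆ Icc c d) ∧
    Pairwise fun a b => Disjoint (S.u a '' Icc c d) (S.u b '' Icc c d)

end RationalIFS

/-- `m ≥ 1` is a period of the shifted word `σ^n(ω)`. -/
def IsPeriodFrom {E : Type*} (ω : ℕ → E) (n m : ℕ) : Prop :=
  0 < m ∧ ∀ i, ω (n + i + m) = ω (n + i)

/-- `ω` is eventually periodic: some shift `σ^n(ω)` is periodic. -/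
def EventuallyPeriodic {E : Type*} (ω : ℕ → E) : Prop :=
  ∃ n m, IsPeriodFrom ω n m

/-- For eventually periodic `ω`, the least `n` such that `σ^n(ω)` is periodic. -/
noncomputable def preperiod {E : Type*} (ω : ℕ → E) : ℕ :=
  sInf {n | ∃ m, IsPeriodFrom ω n m}

/-- For eventually periodic `ω`, the least period of `σ^n(ω)`, where `n` is the preperiod. -/
noncomputable def minPeriod {E : Type*} (ω : ℕ → E) : ℕ :=
  sInf {m | IsPeriodFrom ω (preperiod ω) m}

namespace RationalIFS

variable {E : Type*}

/-- The intrinsic denominator `q₍₁₎ (q₍₂₎ - p₍₂₎)` with respect to a triple `(ω, n, m)`, where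
`q₍₁₎ = q_{ω_0} ⋯ q_{ω_{n-1}}`, `q₍₂₎ = q_{ω_n} ⋯ q_{ω_{n+m-1}}`,
`p₍₂₎ = p_{ω_n} ⋯ p_{ω_{n+m-1}}`. -/
def intDenomTriple (S : RationalIFS E) (ω : ℕ → E) (n m : ℕ) : ℤ :=
  (∏ i ∈ Finset.range n, (S.q (ω i) : ℤ)) *
    ((∏ i ∈ Finset.range m, (S.q (ω (n + i)) : ℤ)) - ∏ i ∈ Finset.range m, S.p (ω (n + i)))

/-- The intrinsic denominator with respect to an eventually periodic word `ω`: the one for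
`(ω, n, m)` with `n` and `m` minimal. -/
noncomputable def intDenomWord (S : RationalIFS E) (ω : ℕ → E) : ℤ :=
  S.intDenomTriple ω (preperiod ω) (minPeriod ω)

/-- `N` is an intrinsic denominator of the point `y` of the limit set: the intrinsic denominator
with respect to some eventually periodic word that codes `y`. -/
def IsIntrinsicDenom (S : RationalIFS E) (y : ℝ) (N : ℤ) : Prop :=
  ∃ ω : ℕ → E, EventuallyPeriodic ω ∧ S.coding ω = y ∧ S.intDenomWord ω = N

/-- `x ∈ J` is badly symbolically approximable with respect to `ψ`. If all `p_a = ±1` and strong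
separation holds, each rational in `J` has exactly one intrinsic denominator `N`. -/
def BadlySymbApprox (S : RationalIFS E) (ψ : ℝ → ℝ) (x : ℝ) : Prop :=
  x ∈ S.limitSet ∧ ∃ ε : ℝ, 0 < ε ∧ ∀ y : ℚ, (y : ℝ) ∈ S.limitSet →
    ∀ N : ℤ, S.IsIntrinsicDenom (y : ℝ) N → ε * (ψ (N : ℝ) / (N : ℝ)) ≤ |x - (y : ℝ)|

/-- `x ∈ J` is symbolically well approximable with respect to `ψ`: it is not badly so. -/
def WellSymbApprox (S : RationalIFS E) (ψ : ℝ → ℝ) (x : ℝ) : Prop :=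
  x ∈ S.limitSet ∧ ¬ S.BadlySymbApprox ψ x

end RationalIFS

/-- `ψ : (0, ∞) → (0, ∞)` is slowly varying: `ψ(K t) ≍ ψ(t)` for each `K > 0`. -/
def SlowlyVarying (ψ : ℝ → ℝ) : Prop :=
  ∀ K : ℝ, 0 < K → ∃ C : ℝ, 0 < C ∧ ∀ t : ℝ, 0 < t → ψ (K * t) ≤ C * ψ t ∧ ψ t ≤ C * ψ (K * t)

namespace RationalIFS

/-- The limit that defines the coding map exists. -/
theorem tendsto_coding {E : Type*} [Finite E] (S : RationalIFS E) (ω : ℕ → E) :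
    Tendsto (fun n => S.prefixMap ω n 0) atTop (𝓝 (S.coding ω)) := by
  classical
  have := Fintype.ofFinite E
  have : Nonempty E := ⟨ω 0⟩
  obtain ⟨a₀, ha₀⟩ := Finite.exists_max (fun a => |(S.p a : ℝ) / (S.q a : ℝ)|)
  obtain ⟨b₀, hb₀⟩ := Finite.exists_max (fun a => |S.u a 0|)
  have hlt : |(S.p a₀ : ℝ) / (S.q a₀ : ℝ)| < 1 := by
    have h : |(S.p a₀ : ℝ)| < (S.q a₀ : ℝ) := by exact_mod_cast S.abs_p_lt a₀
    have hq : (0 : ℝ) < S.q a₀ := lt_of_le_of_lt (abs_nonneg _) h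
    rw [abs_div, abs_of_pos hq, div_lt_one hq]
    exact h
  have hdiff : ∀ n x y, |S.prefixMap ω n x - S.prefixMap ω n y| ≤
      |(S.p a₀ : ℝ) / (S.q a₀ : ℝ)| ^ n * |x - y| := by
    intro n
    induction n with
    | zero => intro x y; simp [prefixMap]
    | succ n ih =>
      intro x y
      refine (ih _ _).trans ?_
      have : S.u (ω n) x - S.u (ω n) y = (S.p (ω n) : ℝ) / (S.q (ω n) : ℝ) * (x - y) := by
        simp only [u]; ring
      rw [this, abs_mul, pow_succ, mul_assoc]
      exact mul_le_mul_of_nonneg_left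
        (mul_le_mul_of_nonneg_right (ha₀ (ω n)) (abs_nonneg _)) (pow_nonneg (abs_nonneg _) _)
  have hc : CauchySeq (fun n => S.prefixMap ω n 0) := by
    refine cauchySeq_of_le_geometric _ |S.u b₀ 0| hlt fun n => ?_
    rw [Real.dist_eq, abs_sub_comm, mul_comm]
    refine (hdiff n (S.u (ω n) 0) 0).trans ?_
    rw [sub_zero]
    exact mul_le_mul_of_nonneg_left (hb₀ (ω n)) (pow_nonneg (abs_nonneg _) _)
  exact tendsto_nhds_limUnder (cauchySeq_tendsto_of_complete hc)

end RationalIFS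

/-!
The coding map transports the problem to infinite words. Let `s` solve `∑ q_a ^ (-s) = 1` and let
the letters of a word be independent, with law `q_a ^ (-s)`. By strong separation two coded points
are as far apart as the size of the last common cylinder, so the image of the Bernoulli measure
satisfies a Frostman estimate with exponent `s` (`bernoulli_real_le_of_abs_coding_sub_le`). Together
with coverings by cylinders this gives `S.dim = s` (`dim_eq`), and it shows that the normalized
Hausdorff measure is absolutely continuous with respect to the image of the Bernoulli measure
(`ae_measure_of_ae_bernoulli`). It remains to treat almost every word. The intrinsic denominator of
an eventually periodic word is comparable with the denominator of its preperiod followed by one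
period (`intDenomWord_le`, `le_intDenomWord`).

Convergence. A pair of a preperiod and a period of total length `j` is a word of length `j` with a
marked position. Since `∑ den ^ (-s) = 1` over the words of length `j`, the neighbourhoods of
radius of order `ψ(N) / N` of the points so obtained have total measure at most a constant times
`j ψ(2 ^ j / 2) ^ s`. This is summable, and the Borel–Cantelli lemma applies
(`ae_badlySymbApprox_coding`).

Divergence. If a block of denominator about `Q ^ l`, with `Q ^ l` of order `1 / ψ(Q ^ k)`, occurs
early in `ω` and again at the time when the denominator of the prefix reaches `Q ^ k`, then
continuing that prefix periodically from the first occurrence on gives an approximation of the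
required quality (`repeats_subset_approxWords`). At a given scale `k`, the probability of such a
repetition given the past is the measure of the set of blocks seen so far. It is at most
`min 1 (k Q ^ (-l s))`, and by a second moment estimate its mean is of that order: occurrences of a
word at distance `d` overlap with a probability that decays geometrically in `d`
(`le_measure_iUnion_shift_cylinder`). Scales are chosen so sparsely that one attempt is decided
before the next one starts. That costs a factor of `l`, about `|log ψ(Q ^ k)|`, which is the logarithm
in the denominator of the series (`not_summable_min_sparseScale`). Since the sum of the conditional
probabilities is bounded by a multiple of its mean, and has integral at most one over the event that
no attempt succeeds, some attempt succeeds with a probability bounded below by a constant that does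
not depend on the quality `ε` of approximation (`le_measure_iUnion_repeats`). The set of words coding
well approximable points is stable under prepending letters, so a zero-one law gives it full
measure (`ae_mem_wellApproxWords`).
-/

/-! ### Infinite words and Bernoulli measures -/

namespace Words

variable {E : Type*}

/-- The infinite word `a ω₀ ω₁ …`. -/
def cons (a : E) (ω : ℕ → E) : ℕ → E
  | 0 => a
  | i + 1 => ω i

/-- The infinite word `ωₙ ωₙ₊₁ …`. -/
def shift (n : ℕ) (ω : ℕ → E) : ℕ → E := fun i => ω (n + i)

@[simp] lemma cons_zero (a : E) (ω : ℕ → E) : cons a ω 0 = a := rfl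

@[simp] lemma cons_succ (a : E) (ω : ℕ → E) (i : ℕ) : cons a ω (i + 1) = ω i := rfl

lemma shift_apply (n : ℕ) (ω : ℕ → E) (i : ℕ) : shift n ω i = ω (n + i) := rfl

@[simp] lemma shift_zero (ω : ℕ → E) : shift 0 ω = ω := by
  funext i; simp [shift]

lemma shift_shift (n k : ℕ) (ω : ℕ → E) : shift k (shift n ω) = shift (n + k) ω := by
  funext i; simp [shift, add_assoc]

lemma shift_succ_cons (n : ℕ) (a : E) (ω : ℕ → E) : shift (n + 1) (cons a ω) = shift n ω := by
  funext i
  rw [shift_apply, show n + 1 + i = (n + i) + 1 by ring, cons_succ, shift_apply]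

lemma cons_shift_one (ω : ℕ → E) : cons (ω 0) (shift 1 ω) = ω := by
  funext i
  cases i with
  | zero => rfl
  | succ i => simp [shift_apply, add_comm]

lemma dependsOn_mem_cylinder (w : ℕ → E) (n : ℕ) :
    DependsOn (· ∈ PiNat.cylinder w n) (Iio n) := by
  intro x y hxy
  simp only [PiNat.mem_cylinder_iff, eq_iff_iff]
  exact forall₂_congr fun i hi => by rw [hxy i hi]

variable [MeasurableSpace E]

@[fun_prop] lemma measurable_cons_uncurry :
    Measurable (fun p : E × (ℕ → E) => cons p.1 p.2) := by
  refine measurable_pi_lambda _ fun i => ?_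
  cases i with
  | zero => exact measurable_fst
  | succ i => exact (measurable_pi_apply i).comp measurable_snd

@[fun_prop] lemma measurable_cons (a : E) : Measurable (cons a) :=
  measurable_cons_uncurry.comp (measurable_const.prodMk measurable_id)

@[fun_prop] lemma measurable_shift (n : ℕ) : Measurable (shift (E := E) n) :=
  measurable_pi_lambda _ fun i => measurable_pi_apply (n + i)

/-- The Bernoulli measure on infinite words whose letters are independent with law `m`. -/
noncomputable def bernoulli (m : Measure E) [IsProbabilityMeasure m] : Measure (ℕ → E) :=
  Measure.infinitePi fun _ => m

variable (m : Measure E) [IsProbabilityMeasure m]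

instance : IsProbabilityMeasure (bernoulli m) := by
  unfold bernoulli; infer_instance

/-- Prepending an independent letter preserves a Bernoulli measure. All independence statements
below are derived from this one. -/
lemma map_cons_bernoulli :
    (m.prod (bernoulli m)).map (fun p : E × (ℕ → E) => cons p.1 p.2) = bernoulli m := by
  refine Measure.eq_infinitePi _ fun s t ht => ?_
  have hms : MeasurableSet (Set.pi (s : Set ℕ) t) :=
    MeasurableSet.pi s.countable_toSet fun i _ => ht i
  rw [Measure.map_apply measurable_cons_uncurry hms]
  classical
  set s' : Finset ℕ := s.preimage Nat.succ Nat.succ_injective.injOn with hs'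
  have hpre : (fun p : E × (ℕ → E) => cons p.1 p.2) ⁻¹' (Set.pi (s : Set ℕ) t)
      = (if 0 ∈ s then t 0 else univ) ×ˢ (Set.pi (s' : Set ℕ) fun i => t (i + 1)) := by
    ext ⟨a, ω⟩
    simp only [mem_preimage, Set.mem_pi, mem_prod, Finset.mem_coe, hs', Finset.mem_preimage]
    constructor
    · intro h
      refine ⟨?_, fun i hi => h (i + 1) hi⟩
      split_ifs with h0
      · exact h 0 h0
      · trivial
    · rintro ⟨h0, h⟩ i hi
      cases i with
      | zero => simpa [hi] using h0
      | succ i => exact h i hi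
  rw [hpre, Measure.prod_prod]
  have h2 : bernoulli m (Set.pi (s' : Set ℕ) fun i => t (i + 1)) = ∏ i ∈ s', m (t (i + 1)) :=
    Measure.infinitePi_pi _ fun i _ => ht _
  rw [h2]
  have h3 : ∏ i ∈ s', m (t (i + 1)) = ∏ i ∈ s.erase 0, m (t i) := by
    refine Finset.prod_bij (fun i _ => i + 1) ?_ ?_ ?_ ?_
    · intro i hi; simpa [hs'] using hi
    · intro i _ j _ h; simpa using h
    · intro j hj
      rw [Finset.mem_erase] at hj
      obtain ⟨i, rfl⟩ := Nat.exists_eq_succ_of_ne_zero hj.1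
      exact ⟨i, by simpa [hs'] using hj.2, rfl⟩
    · intro i _; rfl
  rw [h3]
  split_ifs with h0
  · exact Finset.mul_prod_erase s (fun i => m (t i)) h0
  · rw [measure_univ, one_mul, Finset.erase_eq_of_notMem h0]

lemma lintegral_bernoulli {f : (ℕ → E) → ENNReal} (hf : Measurable f) :
    ∫⁻ ω, f ω ∂bernoulli m = ∫⁻ a, ∫⁻ ω, f (cons a ω) ∂bernoulli m ∂m := by
  conv_lhs => rw [← map_cons_bernoulli m]
  rw [lintegral_map hf measurable_cons_uncurry, lintegral_prod]
  exact (hf.comp measurable_cons_uncurry).aemeasurable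

/-- The Markov property at a deterministic time. -/
lemma lintegral_shift_of_dependsOn (n : ℕ) {F : (ℕ → E) → (ℕ → E) → ENNReal}
    (hF : Measurable (Function.uncurry F)) (hdep : DependsOn F (Iio n)) :
    ∫⁻ ω, F ω (shift n ω) ∂bernoulli m = ∫⁻ ω, ∫⁻ ω', F ω ω' ∂bernoulli m ∂bernoulli m := by
  induction n generalizing F with
  | zero =>
    have h : ∀ ω ω', F ω = F ω' := fun ω ω' => hdep fun i hi => by simp at hi
    simp only [shift_zero]
    have h1 : ∀ ω, ∫⁻ ω', F ω ω' ∂bernoulli m = ∫⁻ ω', F ω' ω' ∂bernoulli m := fun ω =>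
      lintegral_congr fun ω' => by rw [h ω ω']
    simp_rw [h1]
    simp
  | succ n ih =>
    have hFs : Measurable fun ω => F ω (shift (n + 1) ω) :=
      hF.comp (measurable_id.prodMk (measurable_shift _))
    rw [lintegral_bernoulli m hFs, lintegral_bernoulli m]
    · refine lintegral_congr fun a => ?_
      simp_rw [shift_succ_cons]
      refine ih (F := fun ω => F (cons a ω)) ?_ ?_
      · exact hF.comp (((measurable_cons a).comp measurable_fst).prodMk measurable_snd)
      · intro x y hxy
        refine hdep fun i hi => ?_
        cases i with
        | zero => rfl
        | succ i => exact hxy i (by simpa using hi)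
    · exact hF.lintegral_prod_right'

/-- The strong Markov property: `T` is a stopping time and `F ω ω'` depends on `ω` only through
the letters before time `T ω`. -/
lemma lintegral_shift_of_stopping {T : (ℕ → E) → ℕ} (hT : Measurable T)
    (hT_det : ∀ ω ω', (∀ i < T ω, ω i = ω' i) → T ω = T ω')
    {F : (ℕ → E) → (ℕ → E) → ENNReal} (hF : Measurable (Function.uncurry F))
    (hdep : ∀ ω ω', (∀ i < T ω, ω i = ω' i) → F ω = F ω') :
    ∫⁻ ω, F ω (shift (T ω) ω) ∂bernoulli m
      = ∫⁻ ω, ∫⁻ ω', F ω ω' ∂bernoulli m ∂bernoulli m := by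
  classical
  set G : ℕ → (ℕ → E) → (ℕ → E) → ENNReal := fun n ω ω' => if T ω = n then F ω ω' else 0 with hG
  have hGm : ∀ n, Measurable (Function.uncurry (G n)) := fun n =>
    Measurable.ite ((measurableSet_singleton n).preimage (hT.comp measurable_fst)) hF
      measurable_const
  have hGd : ∀ n, DependsOn (G n) (Iio n) := by
    intro n x y hxy
    funext ω'
    simp only [hG]
    by_cases hx : T x = n
    · have hxy' : ∀ i < T x, x i = y i := fun i hi => hxy i (by simpa [hx] using hi)
      rw [if_pos hx, if_pos ((hT_det x y hxy').symm.trans hx), hdep x y hxy']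
    · have hy : T y ≠ n := fun hy => hx <| by
        rw [← hy]
        exact (hT_det y x fun i hi => (hxy i (by simpa [hy] using hi)).symm).symm
      rw [if_neg hx, if_neg hy]
  have hsum : ∀ ω ω', F ω ω' = ∑' n, G n ω ω' := fun ω ω' => by
    rw [tsum_eq_single (T ω) fun n hn => by simp [hG, Ne.symm hn]]
    simp [hG]
  have hsum' : ∀ ω, F ω (shift (T ω) ω) = ∑' n, G n ω (shift n ω) := fun ω => by
    rw [tsum_eq_single (T ω) fun n hn => by simp [hG, Ne.symm hn]]
    simp [hG]
  simp_rw [hsum', hsum]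
  have h1 : ∀ n, Measurable fun ω => G n ω (shift n ω) := fun n =>
    (hGm n).comp (measurable_id.prodMk (measurable_shift _))
  rw [lintegral_tsum fun n => (h1 n).aemeasurable]
  have h2 : ∀ ω, ∫⁻ ω', ∑' n, G n ω ω' ∂bernoulli m
      = ∑' n, ∫⁻ ω', G n ω ω' ∂bernoulli m := fun ω =>
    lintegral_tsum fun n => ((hGm n).comp measurable_prodMk_left).aemeasurable
  simp_rw [h2]
  have h3 : ∀ n, Measurable fun ω => ∫⁻ ω', G n ω ω' ∂bernoulli m := fun n =>
    (hGm n).lintegral_prod_right'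
  rw [lintegral_tsum fun n => (h3 n).aemeasurable]
  exact tsum_congr fun n => lintegral_shift_of_dependsOn m n (hGm n) (hGd n)

/-- Letters before time `n` are independent of those from time `n` on. -/
lemma measure_inter_shift_preimage (n : ℕ) {A B : Set (ℕ → E)} (hA : MeasurableSet A)
    (hB : MeasurableSet B) (hdep : DependsOn (· ∈ A) (Iio n)) :
    bernoulli m (A ∩ shift n ⁻¹' B) = bernoulli m A * bernoulli m B := by
  have h := lintegral_shift_of_dependsOn m n
    (F := fun ω ω' => A.indicator 1 ω * B.indicator 1 ω')
    (((measurable_one.indicator hA).comp measurable_fst).mul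
      ((measurable_one.indicator hB).comp measurable_snd))
    (fun x y hxy => by
      have hxA : x ∈ A ↔ y ∈ A := iff_of_eq (hdep hxy)
      funext ω'
      by_cases hx : x ∈ A
      · simp [hx, hxA.1 hx]
      · simp [hx, mt hxA.2 hx])
  have h1 : ∀ ω, A.indicator (1 : (ℕ → E) → ENNReal) ω * B.indicator 1 (shift n ω)
      = (A ∩ shift n ⁻¹' B).indicator 1 ω := fun ω => by
    by_cases ha : ω ∈ A <;> by_cases hb : shift n ω ∈ B <;> simp [indicator, ha, hb]
  simp_rw [h1] at h
  rw [lintegral_indicator_one (hA.inter (measurable_shift n hB))] at h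
  rw [h]
  have h2 : ∀ ω, ∫⁻ ω', A.indicator (1 : (ℕ → E) → ENNReal) ω * B.indicator 1 ω' ∂bernoulli m
      = A.indicator 1 ω * bernoulli m B := fun ω => by
    rw [lintegral_const_mul _ (measurable_one.indicator hB), lintegral_indicator_one hB]
  simp_rw [h2]
  rw [lintegral_mul_const _ (measurable_one.indicator hA), lintegral_indicator_one hA]

lemma measure_shift_preimage (n : ℕ) {B : Set (ℕ → E)} (hB : MeasurableSet B) :
    bernoulli m (shift n ⁻¹' B) = bernoulli m B := by
  have h := measure_inter_shift_preimage m n MeasurableSet.univ hB (fun x y _ => by simp)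
  simpa using h

lemma measurableSet_cylinder [MeasurableSingletonClass E] (w : ℕ → E) (n : ℕ) :
    MeasurableSet (PiNat.cylinder w n) := by
  rw [PiNat.cylinder_eq_pi]
  exact MeasurableSet.pi (Finset.countable_toSet _) fun i _ => measurableSet_singleton _

lemma bernoulli_cylinder [MeasurableSingletonClass E] (w : ℕ → E) (n : ℕ) :
    bernoulli m (PiNat.cylinder w n) = ∏ i ∈ Finset.range n, m {w i} := by
  rw [PiNat.cylinder_eq_pi]
  exact Measure.infinitePi_pi _ fun i _ => measurableSet_singleton _

/-- A zero-one law: a set that the shift maps into itself is null or conull. -/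
lemma measure_eq_zero_or_one_of_subset_shift_preimage {V : Set (ℕ → E)} (hV : MeasurableSet V)
    (hsub : V ⊆ shift 1 ⁻¹' V) : bernoulli m V = 0 ∨ bernoulli m V = 1 := by
  have hsubn : ∀ n, V ⊆ shift n ⁻¹' V := by
    intro n
    induction n with
    | zero => intro ω h; simpa using h
    | succ n ih =>
      intro ω h
      have := hsub (ih h)
      simpa [shift_shift] using this
  have hae : ∀ n, (shift n ⁻¹' V : Set (ℕ → E)) =ᵐ[bernoulli m] V := fun n =>
    (ae_eq_of_subset_of_measure_ge (hsubn n) (measure_shift_preimage m n hV).le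
      hV.nullMeasurableSet (measure_ne_top _ _)).symm
  -- `V` is independent of all cylinder sets, hence of itself.
  have hind : (bernoulli m).restrict V = bernoulli m V • bernoulli m := by
    refine ext_of_generate_finite (measurableCylinders fun _ : ℕ => E)
      (generateFrom_measurableCylinders).symm isPiSystem_measurableCylinders ?_ (by simp)
    intro A hA
    obtain ⟨s, S, hS, rfl⟩ := (mem_measurableCylinders _).1 hA
    have hmeas : MeasurableSet (MeasureTheory.cylinder (α := fun _ : ℕ => E) s S) :=
      MeasurableSet.cylinder s hS
    obtain ⟨n, hn⟩ : ∃ n, ∀ i ∈ s, i < n := ⟨s.sup id + 1, fun i hi =>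
      Nat.lt_succ_of_le (Finset.le_sup (f := id) hi)⟩
    rw [Measure.restrict_apply hmeas, Measure.smul_apply, smul_eq_mul, mul_comm]
    rw [← measure_inter_shift_preimage m n hmeas hV]
    · exact measure_congr ((ae_eq_refl _).inter (hae n).symm)
    · intro x y hxy
      have : s.restrict x = s.restrict y := by
        funext i; exact hxy i (hn i i.2)
      simp only [mem_cylinder, this]
  have h := congrArg (fun ν : Measure (ℕ → E) => ν V) hind
  simp only [Measure.restrict_apply hV, inter_self, Measure.smul_apply, smul_eq_mul] at h
  by_cases h0 : bernoulli m V = 0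
  · exact Or.inl h0
  · right
    have := (ENNReal.mul_eq_left h0 (measure_ne_top _ _)).1 h.symm
    exact this

lemma measurable_of_dependsOn [Finite E] [MeasurableSingletonClass E] {β : Type*} [Nonempty β]
    [MeasurableSpace β] {f : (ℕ → E) → β} (n : ℕ) (hf : DependsOn f (Iio n)) : Measurable f := by
  obtain ⟨g, rfl⟩ := dependsOn_iff_exists_comp.1 hf
  have : Finite (Iio n) := (finite_Iio n)
  have hg : Measurable g := measurable_of_countable g
  exact hg.comp (measurable_pi_lambda _ fun i => measurable_pi_apply _)

end Words

/-! ### Occurrences of a finite word in a random word -/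

namespace Words

variable {E : Type*}

lemma sum_pow_le_of_injOn {θ : ℝ} (h0 : 0 ≤ θ) (h1 : θ < 1) {s : Finset ℕ} {f : ℕ → ℕ}
    (hf : Set.InjOn f s) : ∑ i ∈ s, θ ^ f i ≤ (1 - θ)⁻¹ := by
  rw [← Finset.sum_image (f := fun k => θ ^ k) hf, ← tsum_geometric_of_lt_one h0 h1]
  exact (summable_geometric_of_lt_one h0 h1).sum_le_tsum _ fun _ _ => pow_nonneg h0 _

lemma sum_pow_dist_le {θ : ℝ} (h0 : 0 ≤ θ) (h1 : θ < 1) (M n : ℕ) :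
    ∑ k ∈ Finset.range M, θ ^ Nat.dist n k ≤ 2 * (1 - θ)⁻¹ := by
  rw [← Finset.sum_filter_add_sum_filter_not _ (fun k => k ≤ n), two_mul]
  refine add_le_add (sum_pow_le_of_injOn h0 h1 ?_) (sum_pow_le_of_injOn h0 h1 ?_)
  · intro i hi j hj h
    simp only [Finset.coe_filter, mem_ofPred_eq] at hi hj
    simp only [Nat.dist] at h
    omega
  · intro i hi j hj h
    simp only [Finset.coe_filter, mem_ofPred_eq] at hi hj
    simp only [Nat.dist] at h
    omega

variable [MeasurableSpace E] [MeasurableSingletonClass E] (m : Measure E)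
  [IsProbabilityMeasure m] {θ : ℝ} (hθ : ∀ a, m.real {a} ≤ θ)

lemma bernoulli_real_cylinder (w : ℕ → E) (n : ℕ) :
    (bernoulli m).real (PiNat.cylinder w n) = ∏ i ∈ Finset.range n, m.real {w i} := by
  rw [measureReal_def, bernoulli_cylinder, ENNReal.toReal_prod]
  rfl

include hθ in
lemma bernoulli_real_cylinder_le (w : ℕ → E) (n : ℕ) :
    (bernoulli m).real (PiNat.cylinder w n) ≤ θ ^ n := by
  rw [bernoulli_real_cylinder]
  calc ∏ i ∈ Finset.range n, m.real {w i} ≤ ∏ _i ∈ Finset.range n, θ :=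
        Finset.prod_le_prod (fun _ _ => measureReal_nonneg) fun i _ => hθ _
    _ = θ ^ n := by simp

include hθ in
/-- Two occurrences at distance `d` of a word either are independent or overlap; in the second case
the last `d` letters are an independent repetition. -/
lemma measure_cylinder_inter_shift_le (w : ℕ → E) (l d : ℕ) :
    (bernoulli m).real (PiNat.cylinder w l ∩ shift d ⁻¹' PiNat.cylinder w l)
      ≤ (bernoulli m).real (PiNat.cylinder w l)
        * (θ ^ d + (bernoulli m).real (PiNat.cylinder w l)) := by
  have hθ0 : 0 ≤ θ := measureReal_nonneg.trans (hθ (w 0))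
  have hp : 0 ≤ (bernoulli m).real (PiNat.cylinder w l) := measureReal_nonneg
  rcases le_or_gt l d with h | h
  · have hdep : DependsOn (· ∈ PiNat.cylinder w l) (Iio d) :=
      (dependsOn_mem_cylinder w l).mono (Iio_subset_Iio h)
    rw [measureReal_def, measure_inter_shift_preimage m d (measurableSet_cylinder w l)
      (measurableSet_cylinder w l) hdep, ENNReal.toReal_mul]
    refine mul_le_mul_of_nonneg_left ?_ hp
    have : 0 ≤ θ ^ d := pow_nonneg hθ0 d
    change (bernoulli m).real (PiNat.cylinder w l) ≤ _
    linarith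
  · have hsub : PiNat.cylinder w l ∩ shift d ⁻¹' PiNat.cylinder w l
        ⊆ PiNat.cylinder w l ∩ shift l ⁻¹' PiNat.cylinder (shift (l - d) w) d := by
      rintro ω ⟨h1, h2⟩
      refine ⟨h1, fun i hi => ?_⟩
      have := h2 (l - d + i) (by omega)
      rw [shift_apply] at this
      rw [shift_apply, shift_apply, ← this]
      congr 1
      omega
    refine (measureReal_mono hsub).trans ?_
    rw [measureReal_def, measure_inter_shift_preimage m l (measurableSet_cylinder w l)
      (measurableSet_cylinder _ d) (dependsOn_mem_cylinder w l), ENNReal.toReal_mul]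
    refine mul_le_mul_of_nonneg_left ?_ hp
    exact (bernoulli_real_cylinder_le m hθ _ d).trans (by linarith)

include hθ in
lemma measure_shift_inter_shift_le (w : ℕ → E) (l i j : ℕ) :
    (bernoulli m).real (shift i ⁻¹' PiNat.cylinder w l ∩ shift j ⁻¹' PiNat.cylinder w l)
      ≤ (bernoulli m).real (PiNat.cylinder w l)
        * (θ ^ Nat.dist i j + (bernoulli m).real (PiNat.cylinder w l)) := by
  wlog hij : i ≤ j generalizing i j
  · rw [inter_comm, Nat.dist_comm]
    exact this j i (le_of_not_ge hij)
  have heq : shift i ⁻¹' PiNat.cylinder w l ∩ shift j ⁻¹' PiNat.cylinder w l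
      = shift i ⁻¹' (PiNat.cylinder w l ∩ shift (j - i) ⁻¹' PiNat.cylinder w l) := by
    ext ω
    simp only [mem_inter_iff, mem_preimage, shift_shift, Nat.add_sub_cancel' hij]
  rw [heq, measureReal_def, measure_shift_preimage m i ((measurableSet_cylinder w l).inter
    (measurable_shift _ (measurableSet_cylinder w l))), Nat.dist_eq_sub_of_le hij]
  exact measure_cylinder_inter_shift_le m hθ w l (j - i)

include hθ in
/-- A lower bound for the probability that a given word occurs at one of the first `M` positions,
by the second moment method. -/
lemma le_measure_iUnion_shift_cylinder (hθ1 : θ < 1) (w : ℕ → E) (l M : ℕ) :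
    M * (bernoulli m).real (PiNat.cylinder w l)
        / (2 * (1 - θ)⁻¹ * (1 + M * (bernoulli m).real (PiNat.cylinder w l)))
      ≤ (bernoulli m).real {ω | ∃ n < M, shift n ω ∈ PiNat.cylinder w l} := by
  classical
  have hθ0 : 0 ≤ θ := measureReal_nonneg.trans (hθ (w 0))
  set p := (bernoulli m).real (PiNat.cylinder w l) with hpdef
  have hp : 0 ≤ p := measureReal_nonneg
  set κ := 2 * (1 - θ)⁻¹ with hκ
  have hκ1 : 1 ≤ κ := by
    have : 1 ≤ (1 - θ)⁻¹ := (one_le_inv₀ (by linarith)).2 (by linarith)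
    linarith
  set x : ℝ := M * p with hx
  have hx0 : 0 ≤ x := by positivity
  set B : ℕ → Set (ℕ → E) := fun n => shift n ⁻¹' PiNat.cylinder w l with hB
  have hBm : ∀ n, MeasurableSet (B n) := fun n =>
    measurable_shift n (measurableSet_cylinder w l)
  have hBp : ∀ n, (bernoulli m).real (B n) = p := fun n => by
    rw [measureReal_def, measure_shift_preimage m n (measurableSet_cylinder w l)]; rfl
  set U : Set (ℕ → E) := {ω | ∃ n < M, shift n ω ∈ PiNat.cylinder w l} with hU
  have hUm : MeasurableSet U := by
    have : U = ⋃ n ∈ Finset.range M, B n := by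
      ext ω; simp [hU, hB]
    rw [this]
    exact Finset.measurableSet_biUnion _ fun n _ => hBm n
  set X : (ℕ → E) → ℝ := fun ω => ∑ n ∈ Finset.range M, (B n).indicator 1 ω with hXdef
  have hint1 : ∀ A : Set (ℕ → E), MeasurableSet A →
      Integrable (A.indicator (1 : (ℕ → E) → ℝ)) (bernoulli m) := fun A hA =>
    (integrable_const (1 : ℝ)).indicator hA
  have hX : ∫ ω, X ω ∂bernoulli m = x := by
    rw [integral_finsetSum _ fun n _ => hint1 _ (hBm n)]
    simp_rw [integral_indicator_one (hBm _), hBp]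
    simp [hx]
  have hXX : ∀ ω, X ω ^ 2
      = ∑ i ∈ Finset.range M, ∑ j ∈ Finset.range M, (B i ∩ B j).indicator 1 ω := fun ω => by
    rw [sq, hXdef, Finset.sum_mul_sum]
    refine Finset.sum_congr rfl fun i _ => Finset.sum_congr rfl fun j _ => ?_
    rw [inter_indicator_one]; rfl
  have hXint : Integrable X (bernoulli m) := integrable_finsetSum _ fun n _ => hint1 _ (hBm n)
  have hX2int : Integrable (fun ω => X ω ^ 2) (bernoulli m) := by
    simp_rw [hXX]
    exact integrable_finsetSum _ fun i _ => integrable_finsetSum _ fun j _ =>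
      hint1 _ ((hBm i).inter (hBm j))
  have hX2 : ∫ ω, X ω ^ 2 ∂bernoulli m ≤ κ * (x * (1 + x)) := by
    simp_rw [hXX]
    rw [integral_finsetSum _ fun i _ => integrable_finsetSum _ fun j _ =>
      hint1 _ ((hBm i).inter (hBm j))]
    have hi : ∀ i, ∫ ω, ∑ j ∈ Finset.range M, (B i ∩ B j).indicator (1 : (ℕ → E) → ℝ) ω
        ∂bernoulli m ≤ p * (κ + M * p) := by
      intro i
      rw [integral_finsetSum _ fun j _ => hint1 _ ((hBm i).inter (hBm j))]
      simp_rw [integral_indicator_one ((hBm i).inter (hBm _))]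
      calc ∑ j ∈ Finset.range M, (bernoulli m).real (B i ∩ B j)
          ≤ ∑ j ∈ Finset.range M, p * (θ ^ Nat.dist i j + p) :=
            Finset.sum_le_sum fun j _ => measure_shift_inter_shift_le m hθ w l i j
        _ = p * (∑ j ∈ Finset.range M, θ ^ Nat.dist i j + M * p) := by
            rw [← Finset.mul_sum, Finset.sum_add_distrib]; simp
        _ ≤ p * (κ + M * p) := by
            gcongr
            exact sum_pow_dist_le hθ0 hθ1 M i
    calc ∑ i ∈ Finset.range M, ∫ ω, ∑ j ∈ Finset.range M,
          (B i ∩ B j).indicator (1 : (ℕ → E) → ℝ) ω ∂bernoulli m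
        ≤ ∑ i ∈ Finset.range M, p * (κ + M * p) := Finset.sum_le_sum fun i _ => hi i
      _ = x * (κ + x) := by simp [hx]; ring
      _ ≤ κ * (x * (1 + x)) := by nlinarith [mul_nonneg hx0 hx0]
  -- `1 ≥ 2tX - (tX)²`, and both sides vanish where no occurrence exists.
  have hkey : ∀ t : ℝ, 2 * t * x - t ^ 2 * (κ * (x * (1 + x))) ≤ (bernoulli m).real U := by
    intro t
    have hpt : ∀ ω, 2 * t * X ω - t ^ 2 * X ω ^ 2 ≤ U.indicator 1 ω := by
      intro ω
      by_cases hω : ω ∈ U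
      · rw [indicator_of_mem hω, Pi.one_apply]
        nlinarith [sq_nonneg (1 - t * X ω)]
      · have : X ω = 0 := by
          refine Finset.sum_eq_zero fun n hn => indicator_of_notMem (fun h => hω ?_) _
          exact ⟨n, Finset.mem_range.1 hn, h⟩
        rw [indicator_of_notMem hω, this]
        simp
    have h1 := integral_mono ((hXint.const_mul (2 * t)).sub (hX2int.const_mul (t ^ 2)))
      (hint1 U hUm) hpt
    rw [integral_indicator_one hUm] at h1
    have h2 : ∫ ω, ((fun ω => 2 * t * X ω) - fun ω => t ^ 2 * X ω ^ 2) ω ∂bernoulli m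
        = 2 * t * x - t ^ 2 * ∫ ω, X ω ^ 2 ∂bernoulli m := by
      rw [integral_sub' (hXint.const_mul (2 * t)) (hX2int.const_mul (t ^ 2)),
        integral_const_mul, integral_const_mul, hX]
    rw [h2] at h1
    have h3 : t ^ 2 * ∫ ω, X ω ^ 2 ∂bernoulli m ≤ t ^ 2 * (κ * (x * (1 + x))) := by
      gcongr
    linarith
  refine le_trans (le_of_eq ?_) (hkey (κ * (1 + x))⁻¹)
  have : κ ≠ 0 := by positivity
  have : 1 + x ≠ 0 := by positivity
  field_simp
  ring

end Words

/-! ### Denominators, the coding map and periodic words -/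

namespace RationalIFS

open Words

variable {E : Type*} (S : RationalIFS E)

/-- The denominator `q_{ω₀} ⋯ q_{ωₙ₋₁}` of the composition `S.prefixMap ω n`. -/
noncomputable def den (ω : ℕ → E) (n : ℕ) : ℝ := ∏ i ∈ Finset.range n, (S.q (ω i) : ℝ)

@[simp] lemma den_zero (ω : ℕ → E) : S.den ω 0 = 1 := by simp [den]

lemma den_succ (ω : ℕ → E) (n : ℕ) : S.den ω (n + 1) = S.den ω n * S.q (ω n) := by
  simp [den, Finset.prod_range_succ]

lemma den_add (ω : ℕ → E) (n k : ℕ) :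
    S.den ω (n + k) = S.den ω n * S.den (shift n ω) k := by
  simp [den, Finset.prod_range_add, shift]

lemma den_cons (a : E) (ω : ℕ → E) (n : ℕ) :
    S.den (cons a ω) (n + 1) = S.q a * S.den ω n := by
  simp [den, Finset.prod_range_succ', mul_comm]

lemma den_congr {ω η : ℕ → E} {n : ℕ} (h : ∀ i < n, ω i = η i) : S.den ω n = S.den η n :=
  Finset.prod_congr rfl fun i hi => by rw [h i (Finset.mem_range.1 hi)]

lemma prefixMap_succ_apply (ω : ℕ → E) (n : ℕ) (x : ℝ) :
    S.prefixMap ω (n + 1) x = S.prefixMap ω n (S.u (ω n) x) := rfl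

lemma prefixMap_add (ω : ℕ → E) (n k : ℕ) (x : ℝ) :
    S.prefixMap ω (n + k) x = S.prefixMap ω n (S.prefixMap (shift n ω) k x) := by
  induction k generalizing x with
  | zero => rfl
  | succ k ih => rw [← add_assoc, prefixMap_succ_apply, ih, prefixMap_succ_apply, shift_apply]

lemma prefixMap_congr {ω η : ℕ → E} {n : ℕ} (h : ∀ i < n, ω i = η i) :
    S.prefixMap ω n = S.prefixMap η n := by
  induction n with
  | zero => rfl
  | succ n ih =>
    funext x
    rw [prefixMap_succ_apply, prefixMap_succ_apply, ih fun i hi => h i (by omega),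
      h n (by omega)]

lemma continuous_prefixMap (ω : ℕ → E) (n : ℕ) : Continuous (S.prefixMap ω n) := by
  induction n with
  | zero => exact continuous_id
  | succ n ih =>
    refine ih.comp ?_
    unfold u
    fun_prop

lemma coding_eq_prefixMap [Finite E] (ω : ℕ → E) (n : ℕ) :
    S.coding ω = S.prefixMap ω n (S.coding (shift n ω)) := by
  have h1 : Tendsto (fun k => S.prefixMap ω (n + k) 0) atTop (𝓝 (S.coding ω)) :=
    (S.tendsto_coding ω).comp (tendsto_add_atTop_nat n |>.congr fun k => add_comm k n)
  have h2 : Tendsto (fun k => S.prefixMap ω (n + k) 0) atTop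
      (𝓝 (S.prefixMap ω n (S.coding (shift n ω)))) := by
    simp_rw [prefixMap_add]
    exact ((S.continuous_prefixMap ω n).tendsto _).comp (S.tendsto_coding (shift n ω))
  exact tendsto_nhds_unique h1 h2

lemma prefixMap_one (ω : ℕ → E) : S.prefixMap ω 1 = S.u (ω 0) := rfl

lemma coding_cons [Finite E] (a : E) (ω : ℕ → E) : S.coding (cons a ω) = S.u a (S.coding ω) := by
  rw [S.coding_eq_prefixMap (cons a ω) 1, prefixMap_one, shift_succ_cons, shift_zero, cons_zero]

lemma exists_prefixMap_eq_rat (ω : ℕ → E) (n : ℕ) :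
    ∃ A B : ℚ, ∀ x : ℝ, S.prefixMap ω n x = A * x + B := by
  induction n with
  | zero => exact ⟨1, 0, fun x => by simp [prefixMap]⟩
  | succ n ih =>
    obtain ⟨A, B, h⟩ := ih
    refine ⟨A * (S.p (ω n) / S.q (ω n)), A * (S.r (ω n) / S.q (ω n)) + B, fun x => ?_⟩
    rw [prefixMap_succ_apply, h, u]
    push_cast
    ring

section UnitNumerators

variable (hp : ∀ a, S.p a = 1 ∨ S.p a = -1)
include hp

lemma two_le_q (a : E) : (2 : ℝ) ≤ S.q a := by
  have h := S.abs_p_lt a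
  have h1 : |S.p a| = 1 := by rcases hp a with h | h <;> simp [h]
  rw [h1] at h
  have : 2 ≤ S.q a := by omega
  exact_mod_cast this

lemma two_pow_le_den (ω : ℕ → E) (n : ℕ) : (2 : ℝ) ^ n ≤ S.den ω n := by
  have : ∏ _i ∈ Finset.range n, (2 : ℝ) ≤ S.den ω n :=
    Finset.prod_le_prod (fun _ _ => by norm_num) fun i _ => S.two_le_q hp (ω i)
  simpa using this

lemma one_le_den (ω : ℕ → E) (n : ℕ) : 1 ≤ S.den ω n :=
  (one_le_pow₀ (by norm_num)).trans (S.two_pow_le_den hp ω n)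

lemma den_pos (ω : ℕ → E) (n : ℕ) : 0 < S.den ω n :=
  zero_lt_one.trans_le (S.one_le_den hp ω n)

lemma den_mono (ω : ℕ → E) : Monotone (S.den ω) := by
  refine monotone_nat_of_le_succ fun n => ?_
  rw [den_succ]
  exact le_mul_of_one_le_right (S.den_pos hp ω n).le (by linarith [S.two_le_q hp (ω n)])

lemma tendsto_den (ω : ℕ → E) : Tendsto (S.den ω) atTop atTop :=
  tendsto_atTop_mono (S.two_pow_le_den hp ω) (tendsto_pow_atTop_atTop_of_one_lt (by norm_num))

lemma abs_u_sub (a : E) (x y : ℝ) : |S.u a x - S.u a y| = |x - y| / S.q a := by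
  have h : S.u a x - S.u a y = (S.p a : ℝ) / S.q a * (x - y) := by simp only [u]; ring
  have h1 : |(S.p a : ℝ)| = 1 := by rcases hp a with h | h <;> simp [h]
  rw [h, abs_mul, abs_div, h1, Nat.abs_cast]
  ring

lemma abs_prefixMap_sub (ω : ℕ → E) (n : ℕ) (x y : ℝ) :
    |S.prefixMap ω n x - S.prefixMap ω n y| = |x - y| / S.den ω n := by
  induction n generalizing x y with
  | zero => simp [prefixMap]
  | succ n ih =>
    rw [prefixMap_succ_apply, prefixMap_succ_apply, ih, S.abs_u_sub hp, den_succ, div_div,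
      mul_comm]

/-- A point coded by an eventually periodic word is rational: it is the image under a rational
affine map of the fixed point of a rational affine contraction. -/
lemma exists_rat_eq_coding [Finite E] {ω : ℕ → E} {n m : ℕ} (h : IsPeriodFrom ω n m) :
    ∃ y : ℚ, (y : ℝ) = S.coding ω := by
  have hper : shift m (shift n ω) = shift n ω := by
    funext i
    rw [shift_apply, shift_apply, shift_apply, ← h.2 i]
    congr 1; ring
  set z := S.coding (shift n ω) with hz
  obtain ⟨A, B, hAB⟩ := S.exists_prefixMap_eq_rat (shift n ω) m
  have hfix : z = A * z + B := by
    rw [← hAB]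
    conv_lhs => rw [hz, S.coding_eq_prefixMap (shift n ω) m, hper]
  have hA : (A : ℝ) ≠ 1 := by
    intro hA
    have h1 := S.abs_prefixMap_sub hp (shift n ω) m 1 0
    rw [hAB, hAB, hA] at h1
    have h2 := S.two_pow_le_den hp (shift n ω) m
    have h3 : (2 : ℝ) ^ 1 ≤ 2 ^ m := pow_le_pow_right₀ (by norm_num) h.1
    have h4 : S.den (shift n ω) m = 1 := by
      have hpos := S.den_pos hp (shift n ω) m
      field_simp at h1
      simpa using h1
    rw [h4] at h2
    linarith
  have hA' : (A : ℚ) ≠ 1 := fun h => hA (by exact_mod_cast h)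
  have hzrat : z = ((B / (1 - A) : ℚ) : ℝ) := by
    have : (1 : ℝ) - A ≠ 0 := sub_ne_zero.2 hA.symm
    push_cast
    rw [eq_div_iff this]
    linarith
  obtain ⟨A', B', hAB'⟩ := S.exists_prefixMap_eq_rat ω n
  refine ⟨A' * (B / (1 - A)) + B', ?_⟩
  rw [S.coding_eq_prefixMap ω n, hAB', ← hz, hzrat]
  push_cast
  ring

lemma exists_intDenomTriple_eq (ω : ℕ → E) (n m : ℕ) : ∃ e : ℝ, |e| = 1 ∧
    (S.intDenomTriple ω n m : ℝ) = S.den ω n * (S.den (shift n ω) m - e) := by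
  refine ⟨∏ i ∈ Finset.range m, (S.p (ω (n + i)) : ℝ), ?_, ?_⟩
  · rw [Finset.abs_prod]
    exact Finset.prod_eq_one fun i _ => by rcases hp (ω (n + i)) with h | h <;> simp [h]
  · simp [intDenomTriple, den, shift]

lemma intDenomTriple_le (ω : ℕ → E) (n m : ℕ) :
    (S.intDenomTriple ω n m : ℝ) ≤ 2 * S.den ω (n + m) := by
  obtain ⟨e, he, h⟩ := S.exists_intDenomTriple_eq hp ω n m
  rw [h, den_add]
  have h1 := S.one_le_den hp (shift n ω) m
  have h2 := S.den_pos hp ω n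
  have h3 : -1 ≤ e := (abs_le.1 he.le).1
  nlinarith

lemma le_intDenomTriple (ω : ℕ → E) (n : ℕ) {m : ℕ} (hm : 0 < m) :
    S.den ω (n + m) / 2 ≤ S.intDenomTriple ω n m := by
  obtain ⟨e, he, h⟩ := S.exists_intDenomTriple_eq hp ω n m
  rw [h, den_add]
  have h0 : (2 : ℝ) ^ 1 ≤ 2 ^ m := pow_le_pow_right₀ (by norm_num) hm
  have h1 := S.two_pow_le_den hp (shift n ω) m
  have h2 := S.den_pos hp ω n
  have h3 : e ≤ 1 := (abs_le.1 he.le).2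
  nlinarith

end UnitNumerators

end RationalIFS

lemma IsPeriodFrom.apply_add_mul {E : Type*} {ω : ℕ → E} {n m : ℕ} (h : IsPeriodFrom ω n m)
    (i k : ℕ) : ω (n + i + k * m) = ω (n + i) := by
  induction k with
  | zero => simp
  | succ k ih =>
    rw [← ih, show n + i + (k + 1) * m = n + (i + k * m) + m by ring, h.2]
    congr 1; ring

lemma IsPeriodFrom.apply_mod {E : Type*} {ω : ℕ → E} {n m : ℕ} (h : IsPeriodFrom ω n m)
    (i : ℕ) : ω (n + i) = ω (n + i % m) := by
  rw [← h.apply_add_mul (i % m) (i / m)]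
  congr 1
  have := Nat.mod_add_div' i m
  omega

lemma EventuallyPeriodic.isPeriodFrom {E : Type*} {ω : ℕ → E} (h : EventuallyPeriodic ω) :
    IsPeriodFrom ω (preperiod ω) (minPeriod ω) := by
  have h1 : ∃ m, IsPeriodFrom ω (preperiod ω) m :=
    Nat.sInf_mem (s := {n | ∃ m, IsPeriodFrom ω n m}) h
  exact Nat.sInf_mem (s := {m | IsPeriodFrom ω (preperiod ω) m}) h1

/-- The preperiod and the minimal period are minimal together: a period of any shift is a period
from the preperiod on. -/
lemma IsPeriodFrom.preperiod_le_and_minPeriod_le {E : Type*} {ω : ℕ → E} {n m : ℕ}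
    (h : IsPeriodFrom ω n m) : preperiod ω ≤ n ∧ minPeriod ω ≤ m := by
  have hn : preperiod ω ≤ n := Nat.sInf_le (s := {n | ∃ m, IsPeriodFrom ω n m}) ⟨m, h⟩
  refine ⟨hn, Nat.sInf_le (s := {m | IsPeriodFrom ω (preperiod ω) m}) ⟨h.1, fun i => ?_⟩⟩
  have h0 : IsPeriodFrom ω (preperiod ω) (minPeriod ω) := EventuallyPeriodic.isPeriodFrom ⟨n, m, h⟩
  set N := preperiod ω
  set K := minPeriod ω
  -- Move `N + i` beyond `n` by a multiple of the period `K`.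
  have hK : n ≤ N + i + n * K := by nlinarith [h0.1]
  obtain ⟨j, hj⟩ := Nat.exists_eq_add_of_le hK
  have e1 : ω (N + i + m) = ω (N + (i + m) + n * K) := by
    rw [h0.apply_add_mul]; congr 1; ring
  rw [e1, show N + (i + m) + n * K = n + j + m by omega, h.2, ← hj, h0.apply_add_mul]

namespace RationalIFS

open Words

variable {E : Type*} (S : RationalIFS E) (hp : ∀ a, S.p a = 1 ∨ S.p a = -1)
include hp

lemma intDenomWord_le {ω : ℕ → E} {n m : ℕ} (h : IsPeriodFrom ω n m) :
    (S.intDenomWord ω : ℝ) ≤ 2 * S.den ω (n + m) := by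
  obtain ⟨h1, h2⟩ := h.preperiod_le_and_minPeriod_le
  refine (S.intDenomTriple_le hp ω _ _).trans ?_
  have := S.den_mono hp ω (add_le_add h1 h2)
  linarith

lemma le_intDenomWord {ω : ℕ → E} (h : EventuallyPeriodic ω) :
    S.den ω (preperiod ω + minPeriod ω) / 2 ≤ S.intDenomWord ω :=
  S.le_intDenomTriple hp ω _ h.isPeriodFrom.1

end RationalIFS

/-! ### Geometry of the limit set under strong separation -/

namespace RationalIFS

open Words

variable {E : Type*} (S : RationalIFS E)

/-- The number of letters after which the denominator of the prefix reaches `R`. -/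
noncomputable def level (R : ℝ) (ω : ℕ → E) : ℕ := sInf {n | R ≤ S.den ω n}

variable (hp : ∀ a, S.p a = 1 ∨ S.p a = -1)

section Level

lemma den_lt_of_lt_level {R : ℝ} {ω : ℕ → E} {n : ℕ} (h : n < S.level R ω) : S.den ω n < R :=
  not_le.1 fun h' => Nat.notMem_of_lt_sInf (s := {n | R ≤ S.den ω n}) h h'

lemma level_le {R : ℝ} {ω : ℕ → E} {n : ℕ} (h : R ≤ S.den ω n) : S.level R ω ≤ n :=
  Nat.sInf_le (s := {n | R ≤ S.den ω n}) h

include hp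

lemma le_den_level (R : ℝ) (ω : ℕ → E) : R ≤ S.den ω (S.level R ω) :=
  Nat.sInf_mem (s := {n | R ≤ S.den ω n}) ((S.tendsto_den hp ω).eventually_ge_atTop R).exists

lemma le_level_of_den_lt {R : ℝ} {ω : ℕ → E} {n : ℕ} (h : S.den ω n < R) : n < S.level R ω := by
  by_contra h'
  exact absurd ((S.le_den_level hp R ω).trans (S.den_mono hp ω (not_lt.1 h'))) (not_le.2 h)

lemma level_congr {R : ℝ} {ω η : ℕ → E} (h : ∀ i < S.level R ω, ω i = η i) :
    S.level R ω = S.level R η := by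
  have h1 : S.level R η ≤ S.level R ω :=
    S.level_le ((S.le_den_level hp R ω).trans_eq (S.den_congr h))
  refine le_antisymm (S.level_le ?_) h1
  refine (S.le_den_level hp R η).trans_eq (S.den_congr fun i hi => ?_)
  exact (h i (hi.trans_le h1)).symm

lemma level_mono {R R' : ℝ} (h : R ≤ R') (ω : ℕ → E) : S.level R ω ≤ S.level R' ω :=
  S.level_le (h.trans (S.le_den_level hp R' ω))

lemma den_level_lt {Q R : ℝ} (hQ : ∀ a, (S.q a : ℝ) ≤ Q) (hR : 1 < R) (ω : ℕ → E) :
    S.den ω (S.level R ω) < Q * R := by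
  obtain ⟨n, hn⟩ : ∃ n, S.level R ω = n + 1 := Nat.exists_eq_succ_of_ne_zero fun h => by
    have := S.le_den_level hp R ω
    rw [h, den_zero] at this
    linarith
  have h1 : S.den ω n < R := S.den_lt_of_lt_level (by omega)
  have hq := S.two_le_q hp (ω n)
  have := hQ (ω n)
  rw [hn, den_succ]
  have hd := S.den_pos hp ω n
  nlinarith

lemma den_level_le {Q R : ℝ} (hQ : ∀ a, (S.q a : ℝ) ≤ Q) (hR : 1 ≤ R) (ω : ℕ → E) :
    S.den ω (S.level R ω) ≤ Q * R := by
  rcases hR.lt_or_eq with h | rfl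
  · exact (S.den_level_lt hp hQ h ω).le
  · have h0 : S.level 1 ω = 0 := Nat.le_zero.1 (S.level_le (by simp))
    have := S.two_le_q hp (ω 0)
    have := hQ (ω 0)
    rw [h0, den_zero]
    linarith

end Level

section Interval

variable {c d : ℝ} (hmap : ∀ a, S.u a '' Icc c d ⊆ Icc c d)

include hmap in
lemma prefixMap_mem_Icc (ω : ℕ → E) (n : ℕ) {x : ℝ} (hx : x ∈ Icc c d) :
    S.prefixMap ω n x ∈ Icc c d := by
  induction n generalizing x with
  | zero => exact hx
  | succ n ih => exact ih (hmap (ω n) (mem_image_of_mem _ hx))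

include hp hmap in
lemma coding_mem_Icc [Finite E] (hcd : c ≤ d) (ω : ℕ → E) : S.coding ω ∈ Icc c d := by
  have h0 : Tendsto (fun n => |0 - c| / S.den ω n) atTop (𝓝 0) :=
    (S.tendsto_den hp ω).const_div_atTop _
  have h1 : Tendsto (fun n => S.prefixMap ω n 0 - S.prefixMap ω n c) atTop (𝓝 0) := by
    rw [tendsto_zero_iff_abs_tendsto_zero]
    refine h0.congr fun n => ?_
    simp [S.abs_prefixMap_sub hp]
  have h2 : Tendsto (fun n => S.prefixMap ω n c) atTop (𝓝 (S.coding ω)) := by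
    have := (S.tendsto_coding ω).sub h1
    simpa using this
  exact isClosed_Icc.mem_of_tendsto h2
    (Eventually.of_forall fun n => S.prefixMap_mem_Icc hmap ω n (left_mem_Icc.2 hcd))

include hp hmap in
lemma abs_coding_sub_le [Finite E] (hcd : c ≤ d) {ω η : ℕ → E} {n : ℕ}
    (h : ∀ i < n, ω i = η i) : |S.coding ω - S.coding η| ≤ (d - c) / S.den ω n := by
  rw [S.coding_eq_prefixMap ω n, S.coding_eq_prefixMap η n, ← S.prefixMap_congr h,
    S.abs_prefixMap_sub hp]
  have h1 := S.coding_mem_Icc hp hmap hcd (shift n ω)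
  have h2 := S.coding_mem_Icc hp hmap hcd (shift n η)
  have := S.den_pos hp ω n
  gcongr
  exact abs_sub_le_of_le_of_le h1.1 h1.2 h2.1 h2.2

/-- Disjoint images of `[c, d]` under finitely many maps have a common gap. -/
lemma exists_gap [Finite E]
    (hdisj : Pairwise fun a b => Disjoint (S.u a '' Icc c d) (S.u b '' Icc c d)) :
    ∃ κ : ℝ, 0 < κ ∧ ∀ a b, a ≠ b → ∀ x ∈ Icc c d, ∀ y ∈ Icc c d, κ ≤ |S.u a x - S.u b y| := by
  have hc : ∀ a, IsCompact (S.u a '' Icc c d) := fun a =>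
    isCompact_Icc.image (by unfold u; fun_prop)
  have h : ∀ p : E × E, ∃ κ : ℝ, 0 < κ ∧ (p.1 ≠ p.2 → ∀ x ∈ Icc c d, ∀ y ∈ Icc c d,
      κ ≤ |S.u p.1 x - S.u p.2 y|) := by
    rintro ⟨a, b⟩
    by_cases hab : a = b
    · exact ⟨1, one_pos, fun h => absurd hab h⟩
    · obtain ⟨r, hr, hrr⟩ := Metric.exists_pos_forall_lt_edist (hc a) (hc b).isClosed (hdisj hab)
      refine ⟨r, hr, fun _ x hx y hy => ?_⟩
      have := hrr _ (mem_image_of_mem _ hx) _ (mem_image_of_mem _ hy)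
      rw [edist_dist, Real.dist_eq] at this
      have h2 : ENNReal.ofReal r < ENNReal.ofReal |S.u a x - S.u b y| := by simpa using this
      exact ((ENNReal.ofReal_lt_ofReal_iff_of_nonneg r.2).1 h2).le
  choose κ hκ0 hκ using h
  rcases isEmpty_or_nonempty E with hE | hE
  · exact ⟨1, one_pos, fun a => isEmptyElim a⟩
  obtain ⟨p, hpmin⟩ := Finite.exists_min κ
  exact ⟨κ p, hκ0 p, fun a b hab x hx y hy => (hpmin (a, b)).trans (hκ (a, b) hab x hx y hy)⟩

include hp hmap in
/-- If two coded points are closer than `κ / R`, their words agree until the denominator of the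
prefix reaches `R`. -/
lemma eq_of_abs_coding_sub_lt [Finite E] (hcd : c ≤ d) {κ : ℝ} (hκ0 : 0 < κ)
    (hκ : ∀ a b, a ≠ b → ∀ x ∈ Icc c d, ∀ y ∈ Icc c d, κ ≤ |S.u a x - S.u b y|)
    {R : ℝ} (hR : 0 < R) {ω η : ℕ → E} (h : |S.coding ω - S.coding η| * R ≤ κ) :
    ∀ i < S.level R ω, ω i = η i := by
  intro i
  induction i using Nat.strong_induction_on with
  | _ i ih =>
    intro hi
    by_contra hne
    have hagree : ∀ j < i, ω j = η j := fun j hj => ih j hj (hj.trans hi)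
    have h1 : κ / S.den ω i ≤ |S.coding ω - S.coding η| := by
      rw [S.coding_eq_prefixMap ω i, S.coding_eq_prefixMap η i, ← S.prefixMap_congr hagree,
        S.abs_prefixMap_sub hp, S.coding_eq_prefixMap (shift i ω) 1,
        S.coding_eq_prefixMap (shift i η) 1, prefixMap_one, prefixMap_one]
      have := S.den_pos hp ω i
      gcongr
      exact hκ _ _ hne _ (S.coding_mem_Icc hp hmap hcd _) _ (S.coding_mem_Icc hp hmap hcd _)
    have h2 := S.den_lt_of_lt_level hi
    have h3 := S.den_pos hp ω i
    have h4 : κ / R < κ / S.den ω i := by gcongr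
    have h5 : κ < |S.coding ω - S.coding η| * R := by
      rw [← div_lt_iff₀ hR]
      exact h4.trans_le h1
    linarith

include hp hmap in
lemma continuous_coding [Finite E] [TopologicalSpace E] [DiscreteTopology E] (hcd : c ≤ d) :
    Continuous S.coding := by
  rw [continuous_iff_continuousAt]
  intro ω
  rw [ContinuousAt, Metric.tendsto_nhds]
  intro ε hε
  have h0 : Tendsto (fun n => (d - c) / S.den ω n) atTop (𝓝 0) :=
    (S.tendsto_den hp ω).const_div_atTop _
  obtain ⟨n, hn⟩ := ((tendsto_order.1 h0).2 ε hε).exists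
  have hopen : PiNat.cylinder ω n ∈ 𝓝 ω :=
    (PiNat.isOpen_cylinder _ ω n).mem_nhds (PiNat.self_mem_cylinder ω n)
  filter_upwards [hopen] with η hη
  rw [Real.dist_eq, abs_sub_comm]
  exact (S.abs_coding_sub_le hp hmap hcd fun i hi => (hη i hi).symm).trans_lt hn

end Interval

end RationalIFS

/-! ### The similarity dimension and the Hausdorff measure of the limit set -/

namespace RationalIFS

open Words

variable {E : Type*} (S : RationalIFS E)

/-- The similarity dimension: the solution of `∑ q_a^{-s} = 1`. -/
lemma exists_sum_rpow_eq_one [Fintype E] [Nontrivial E] (hp : ∀ a, S.p a = 1 ∨ S.p a = -1) :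
    ∃ s : ℝ, 0 < s ∧ ∑ a, (S.q a : ℝ) ^ (-s) = 1 := by
  have hq := S.two_le_q hp
  set f : ℝ → ℝ := fun s => ∑ a, (S.q a : ℝ) ^ (-s) with hf
  have hcont : Continuous f := by
    refine continuous_finsetSum _ fun a _ => ?_
    exact Real.continuous_const_rpow (by linarith [hq a]) |>.comp continuous_neg
  have h0 : 1 < f 0 := by
    have : (1 : ℝ) < Fintype.card E := by exact_mod_cast Fintype.one_lt_card
    simpa [hf] using this
  have hlim : Tendsto f atTop (𝓝 0) := by
    have : Tendsto f atTop (𝓝 (∑ _a : E, (0 : ℝ))) := by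
      refine tendsto_finsetSum _ fun a _ => ?_
      have h := tendsto_rpow_atBot_of_base_gt_one (S.q a : ℝ) (by linarith [hq a])
      exact h.comp tendsto_neg_atTop_atBot
    simpa using this
  obtain ⟨t, ht, htpos⟩ := (((tendsto_order.1 hlim).2 1 one_pos).and (eventually_ge_atTop 0)).exists
  obtain ⟨s, hs, hs1⟩ := intermediate_value_Icc' htpos hcont.continuousOn ⟨ht.le, h0.le⟩
  refine ⟨s, hs.1.lt_of_ne fun h => ?_, hs1⟩
  rw [← h] at hs1
  exact h0.ne' hs1

lemma exists_letter_law [Fintype E] [MeasurableSpace E] [MeasurableSingletonClass E] {s : ℝ}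
    (hs : ∑ a, (S.q a : ℝ) ^ (-s) = 1) :
    ∃ m : Measure E, IsProbabilityMeasure m ∧ ∀ a, m.real {a} = (S.q a : ℝ) ^ (-s) := by
  classical
  have hnn : ∀ a, 0 ≤ (S.q a : ℝ) ^ (-s) := fun a => Real.rpow_nonneg (Nat.cast_nonneg _) _
  set m : Measure E := ∑ a, ENNReal.ofReal ((S.q a : ℝ) ^ (-s)) • Measure.dirac a with hm
  refine ⟨m, ⟨?_⟩, fun a => ?_⟩
  · simp only [hm, Measure.finsetSum_apply, Measure.smul_apply, measure_univ, smul_eq_mul, mul_one]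
    rw [← ENNReal.ofReal_sum_of_nonneg fun a _ => hnn a, hs, ENNReal.ofReal_one]
  · have : m {a} = ENNReal.ofReal ((S.q a : ℝ) ^ (-s)) := by
      simp only [hm, Measure.finsetSum_apply, Measure.smul_apply, smul_eq_mul,
        Measure.dirac_apply' _ (measurableSet_singleton a)]
      rw [Finset.sum_eq_single a] <;> simp +contextual
    rw [measureReal_def, this, ENNReal.toReal_ofReal (hnn a)]

section

variable [MeasurableSpace E] (m : Measure E) {s : ℝ}
  (hm : ∀ a, m.real {a} = (S.q a : ℝ) ^ (-s))
  (hp : ∀ a, S.p a = 1 ∨ S.p a = -1) (hs : 0 < s)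

include hm hp hs in
lemma measureReal_singleton_le (a : E) : m.real {a} ≤ (2 : ℝ) ^ (-s) := by
  rw [hm]
  exact Real.rpow_le_rpow_of_nonpos two_pos (S.two_le_q hp a) (by linarith)

variable [MeasurableSingletonClass E] [IsProbabilityMeasure m]

include hm in
lemma bernoulli_real_cylinder_eq (ω : ℕ → E) (n : ℕ) :
    (bernoulli m).real (PiNat.cylinder ω n) = S.den ω n ^ (-s) := by
  rw [bernoulli_real_cylinder, den, ← Real.finsetProd_rpow _ _ fun _ _ => Nat.cast_nonneg _]
  exact Finset.prod_congr rfl fun i _ => hm _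

include hm hp hs in
lemma bernoulli_real_cylinder_level_le {R : ℝ} (hR : 0 < R) (ω : ℕ → E) :
    (bernoulli m).real (PiNat.cylinder ω (S.level R ω)) ≤ R ^ (-s) := by
  rw [S.bernoulli_real_cylinder_eq m hm]
  exact Real.rpow_le_rpow_of_nonpos hR (S.le_den_level hp R ω) (by linarith)

end

section

variable [Finite E] [TopologicalSpace E] [DiscreteTopology E] [MeasurableSpace E] [BorelSpace E]
  (m : Measure E) [IsProbabilityMeasure m] {s : ℝ}
  (hm : ∀ a, m.real {a} = (S.q a : ℝ) ^ (-s))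

variable (hp : ∀ a, S.p a = 1 ∨ S.p a = -1) (hs : 0 < s)

variable {c d : ℝ} (hcd : c ≤ d) (hmap : ∀ a, S.u a '' Icc c d ⊆ Icc c d)

section Gap

variable {κ : ℝ} (hκ0 : 0 < κ)
  (hκ : ∀ a b, a ≠ b → ∀ x ∈ Icc c d, ∀ y ∈ Icc c d, κ ≤ |S.u a x - S.u b y|)

include hm hp hs hcd hmap hκ0 hκ in
/-- The Frostman estimate for the coded Bernoulli measure. -/
lemma bernoulli_real_le_of_abs_coding_sub_le {V : Set (ℕ → E)} {r : ℝ} (hr : 0 ≤ r)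
    (hV : ∀ ω ∈ V, ∀ η ∈ V, |S.coding ω - S.coding η| ≤ r) :
    (bernoulli m).real V ≤ (r / κ) ^ s := by
  rcases V.eq_empty_or_nonempty with rfl | ⟨ω, hω⟩
  · simpa using Real.rpow_nonneg (div_nonneg hr hκ0.le) s
  have hle : ∀ R : ℝ, 0 < R → r * R ≤ κ → (bernoulli m).real V ≤ R ^ (-s) := by
    intro R hR hrR
    refine (measureReal_mono ?_).trans (S.bernoulli_real_cylinder_level_le m hm hp hs hR ω)
    intro η hη i hi
    refine (S.eq_of_abs_coding_sub_lt hp hmap hcd hκ0 hκ hR ?_ i hi).symm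
    exact (mul_le_mul_of_nonneg_right (hV ω hω η hη) hR.le).trans hrR
  rcases hr.eq_or_lt with rfl | hr
  · rw [zero_div, Real.zero_rpow hs.ne']
    refine ge_of_tendsto (tendsto_rpow_neg_atTop hs) ?_
    filter_upwards [eventually_gt_atTop 0] with R hR
    exact hle R hR (by rw [zero_mul]; exact hκ0.le)
  · have := hle (κ / r) (by positivity) (by rw [mul_div_cancel₀ _ hr.ne'])
    rwa [Real.rpow_neg (by positivity), ← Real.inv_rpow (by positivity), inv_div] at this

include hm hp hs hcd hmap hκ0 hκ in
/-- Mass distribution principle for the limit set. -/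
lemma hausdorffMeasure_limitSet_pos : Measure.hausdorffMeasure s S.limitSet ≠ 0 := by
  have hcont := S.continuous_coding hp hmap hcd
  have hle : ENNReal.ofReal (κ ^ s) • (bernoulli m).map S.coding ≤ Measure.hausdorffMeasure s := by
    refine Measure.le_hausdorffMeasure s _ 1 one_pos fun A hA => ?_
    have hfin : Metric.ediam A ≠ ⊤ := (hA.trans_lt ENNReal.one_lt_top).ne
    rw [← Metric.ediam_closure] at hfin ⊢
    have h1 : (bernoulli m).map S.coding A ≤ bernoulli m (S.coding ⁻¹' closure A) :=
      (measure_mono subset_closure).trans_eq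
        (Measure.map_apply hcont.measurable isClosed_closure.measurableSet)
    have h2 : (bernoulli m).real (S.coding ⁻¹' closure A) ≤ (Metric.diam (closure A) / κ) ^ s :=
      S.bernoulli_real_le_of_abs_coding_sub_le m hm hp hs hcd hmap hκ0 hκ Metric.diam_nonneg
        fun ω hω η hη => by
          rw [← Real.dist_eq]
          exact Metric.dist_le_diam_of_mem (Metric.isBounded_iff_ediam_ne_top.2 hfin) hω hη
    have h3 : bernoulli m (S.coding ⁻¹' closure A)
        ≤ ENNReal.ofReal ((Metric.diam (closure A) / κ) ^ s) := by
      rw [← ofReal_measureReal]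
      exact ENNReal.ofReal_le_ofReal h2
    rw [Measure.smul_apply, smul_eq_mul]
    refine (mul_le_mul_right (h1.trans h3) _).trans_eq ?_
    rw [← ENNReal.ofReal_mul (by positivity), ← Real.mul_rpow hκ0.le (by positivity),
      mul_div_cancel₀ _ hκ0.ne', ← ENNReal.ofReal_rpow_of_nonneg Metric.diam_nonneg hs.le]
    rw [Metric.diam, ENNReal.ofReal_toReal hfin]
  have h1 := hle S.limitSet
  intro h0
  rw [h0, Measure.smul_apply, smul_eq_mul, nonpos_iff_eq_zero, mul_eq_zero] at h1
  have hcomp : IsCompact S.limitSet := isCompact_range hcont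
  rw [Measure.map_apply hcont.measurable hcomp.measurableSet] at h1
  rcases h1 with h1 | h1
  · rw [ENNReal.ofReal_eq_zero] at h1
    exact absurd (Real.rpow_pos_of_pos hκ0 s) (not_lt.2 h1)
  · have : S.coding ⁻¹' S.limitSet = univ := eq_univ_of_forall fun ω => mem_range_self ω
    simp [this] at h1

end Gap

include hm hp hs hcd hmap in
/-- Covering by the pieces of the limit set whose cylinders lie in `O`. -/
lemma hausdorffMeasure_image_coding_le {O : Set (ℕ → E)} (hO : IsOpen O) :
    Measure.hausdorffMeasure s (S.coding '' O)
      ≤ ENNReal.ofReal ((d - c) ^ s) * bernoulli m O := by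
  classical
  have := Fintype.ofFinite E
  set A : ℕ → Set ℝ := fun n => S.coding '' {ω | PiNat.cylinder ω n ⊆ O} with hA
  have hmono : Monotone A := fun n k hnk =>
    image_mono fun ω hω => (PiNat.cylinder_anti ω hnk).trans hω
  have hcover : S.coding '' O ⊆ ⋃ n, A n := by
    rintro _ ⟨ω, hω, rfl⟩
    obtain ⟨v, ⟨n, hn⟩, hωv, hvO⟩ :=
      (PiNat.isTopologicalBasis_cylinders fun _ : ℕ => E).exists_subset_of_mem_open hω hO
    obtain ⟨k, rfl⟩ := hn
    refine mem_iUnion.2 ⟨k, ω, ?_, rfl⟩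
    rw [mem_ofPred_eq]
    rwa [PiNat.mem_cylinder_iff_eq.1 hωv]
  refine (measure_mono hcover).trans ?_
  rw [hmono.measure_iUnion]
  refine iSup_le fun n => ?_
  set t : ∀ k : ℕ, (Fin k → E) → Set ℝ := fun k γ =>
    S.coding '' {ω | PiNat.cylinder ω k ⊆ O ∧ ∀ i : Fin k, ω i = γ i} with ht
  have hdiam : ∀ k γ ω, (∀ i : Fin k, ω i = γ i) →
      Metric.ediam (t k γ) ≤ ENNReal.ofReal ((d - c) / S.den ω k) := by
    intro k γ ω hω
    refine Metric.ediam_le ?_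
    rintro _ ⟨η, hη, rfl⟩ _ ⟨η', hη', rfl⟩
    rw [edist_dist, Real.dist_eq]
    refine ENNReal.ofReal_le_ofReal ?_
    have hden : S.den ω k = S.den η k := S.den_congr fun i hi => by
      rw [hω ⟨i, hi⟩, hη.2 ⟨i, hi⟩]
    rw [hden]
    exact S.abs_coding_sub_le hp hmap hcd fun i hi => by rw [hη.2 ⟨i, hi⟩, hη'.2 ⟨i, hi⟩]
  have hr0 : Tendsto (fun k : ℕ => ENNReal.ofReal ((d - c) / 2 ^ k)) atTop (𝓝 0) := by
    rw [← ENNReal.ofReal_zero]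
    refine ENNReal.tendsto_ofReal ?_
    exact (tendsto_pow_atTop_atTop_of_one_lt one_lt_two).const_div_atTop _
  refine (Measure.hausdorffMeasure_le_liminf_sum s (A n) _ hr0 t ?_ ?_).trans ?_
  · refine Eventually.of_forall fun k γ => ?_
    rcases (t k γ).eq_empty_or_nonempty with h | ⟨_, ω, hω, rfl⟩
    · simp [h]
    · refine (hdiam k γ ω hω.2).trans (ENNReal.ofReal_le_ofReal ?_)
      have h1 := S.two_pow_le_den hp ω k
      have h2 : 0 ≤ d - c := by linarith
      gcongr
  · filter_upwards [eventually_ge_atTop n] with k hk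
    rintro _ ⟨ω, hω, rfl⟩
    exact mem_iUnion.2 ⟨fun i => ω i, ω, ⟨(PiNat.cylinder_anti ω hk).trans hω, fun i => rfl⟩, rfl⟩
  · refine (liminf_le_liminf (v := fun _ => ENNReal.ofReal ((d - c) ^ s) * bernoulli m O)
      (Eventually.of_forall fun k => ?_)).trans_eq (liminf_const _)
    have hmeas : ∀ γ : Fin k → E, MeasurableSet ((fun (ω : ℕ → E) (i : Fin k) => ω i) ⁻¹' {γ}) :=
      fun γ => (measurable_pi_lambda _ fun i => measurable_pi_apply _) (measurableSet_singleton γ)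
    have hsum : ∑ γ : Fin k → E,
        bernoulli m (O ∩ (fun (ω : ℕ → E) (i : Fin k) => ω i) ⁻¹' {γ}) = bernoulli m O := by
      rw [← tsum_fintype (L := .unconditional _), ← measure_iUnion]
      · rw [← inter_iUnion, inter_eq_left.2 fun ω _ => mem_iUnion.2 ⟨fun i => ω i, rfl⟩]
      · intro γ γ' hne
        refine Disjoint.mono inter_subset_right inter_subset_right ?_
        exact Disjoint.preimage _ (disjoint_singleton.2 hne)
      · exact fun γ => hO.measurableSet.inter (hmeas γ)
    rw [← hsum, Finset.mul_sum]
    refine Finset.sum_le_sum fun γ _ => ?_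
    rcases (t k γ).eq_empty_or_nonempty with h | ⟨_, ω, hω, rfl⟩
    · simp [h, ENNReal.zero_rpow_of_pos hs]
    · have hsub : PiNat.cylinder ω k ⊆ O ∩ (fun (ω : ℕ → E) (i : Fin k) => ω i) ⁻¹' {γ} :=
        fun η hη => ⟨hω.1 hη, funext fun i => (hη i i.2).trans (hω.2 i)⟩
      refine le_trans ?_ (mul_le_mul_right (measure_mono hsub) _)
      rw [← ofReal_measureReal, S.bernoulli_real_cylinder_eq m hm,
        ← ENNReal.ofReal_mul (Real.rpow_nonneg (by linarith) _)]
      have hden := S.den_pos hp ω k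
      have h2 : 0 ≤ d - c := by linarith
      have : (d - c) ^ s * S.den ω k ^ (-s) = ((d - c) / S.den ω k) ^ s := by
        rw [Real.div_rpow h2 hden.le, Real.rpow_neg hden.le]; rfl
      rw [this, ← ENNReal.ofReal_rpow_of_nonneg (by positivity) hs.le]
      exact ENNReal.rpow_le_rpow (hdiam k γ ω hω.2) hs.le

include hm hp hs hcd hmap in
lemma hausdorffMeasure_image_coding_eq_zero {V : Set (ℕ → E)} (hV : bernoulli m V = 0) :
    Measure.hausdorffMeasure s (S.coding '' V) = 0 := by
  refine le_antisymm (le_of_forall_gt fun ε hε => ?_) zero_le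
  have hlim : Tendsto (fun x : ENNReal => ENNReal.ofReal ((d - c) ^ s) * x) (𝓝 0) (𝓝 0) := by
    have := ENNReal.Tendsto.const_mul (tendsto_id (x := 𝓝 (0 : ENNReal)))
      (Or.inr (ENNReal.ofReal_ne_top (r := (d - c) ^ s)))
    simpa using this
  obtain ⟨δ, hδ0, hδ⟩ : ∃ δ : ENNReal, 0 < δ ∧ ∀ x < δ, ENNReal.ofReal ((d - c) ^ s) * x < ε := by
    have := (tendsto_order.1 hlim).2 ε hε
    rw [ENNReal.nhds_zero_basis.eventually_iff] at this
    obtain ⟨δ, h0, h⟩ := this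
    exact ⟨δ, h0, fun x hx => h hx⟩
  obtain ⟨O, hVO, hO, hlt⟩ := V.exists_isOpen_lt_of_lt (μ := bernoulli m) δ (by rwa [hV])
  exact ((measure_mono (image_mono hVO)).trans
    (S.hausdorffMeasure_image_coding_le m hm hp hs hcd hmap hO)).trans_lt (hδ _ hlt)

include hm hp hs hcd hmap in
lemma dim_eq {κ : ℝ} (hκ0 : 0 < κ)
    (hκ : ∀ a b, a ≠ b → ∀ x ∈ Icc c d, ∀ y ∈ Icc c d, κ ≤ |S.u a x - S.u b y|) :
    S.dim = s := by
  have htop : Measure.hausdorffMeasure s S.limitSet ≠ ⊤ := by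
    have h := S.hausdorffMeasure_image_coding_le m hm hp hs hcd hmap isOpen_univ
    rw [image_univ] at h
    refine (h.trans_lt ?_).ne
    exact ENNReal.mul_lt_top ENNReal.ofReal_lt_top (measure_lt_top _ _)
  have h0 := S.hausdorffMeasure_limitSet_pos m hm hp hs hcd hmap hκ0 hκ
  have hs' : (s.toNNReal : ℝ) = s := Real.coe_toNNReal s hs.le
  rw [← hs'] at h0 htop
  rw [dim, dimH_of_hausdorffMeasure_ne_zero_ne_top h0 htop]
  simpa using hs'

include hm hp hs hcd hmap in
/-- The normalized Hausdorff measure is absolutely continuous with respect to the coded Bernoulli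
measure. -/
lemma ae_measure_of_ae_bernoulli (hdim : S.dim = s) {p : ℝ → Prop}
    (h : ∀ᵐ ω ∂bernoulli m, p (S.coding ω)) : ∀ᵐ x ∂S.measure, p x := by
  refine Measure.ae_smul_measure ?_ _
  have hcomp : IsCompact S.limitSet := isCompact_range (S.continuous_coding hp hmap hcd)
  rw [ae_iff, Measure.restrict_apply' hcomp.measurableSet, hdim]
  refine measure_mono_null ?_ (S.hausdorffMeasure_image_coding_eq_zero m hm hp hs hcd hmap h)
  rintro _ ⟨hx, ω, rfl⟩
  exact ⟨ω, hx, rfl⟩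

end

end RationalIFS

/-! ### Recurrence of long words -/

namespace RationalIFS

open Words

variable {E : Type*} (S : RationalIFS E)

/-- The words whose prefix of denominator about `R` occurs in `ω` at a position less than `M`. -/
def recurring (R : ℝ) (M : ℕ) (ω : ℕ → E) : Set (ℕ → E) :=
  {η | ∃ n < M, shift n ω ∈ PiNat.cylinder η (S.level R η)}

/-- The event that an earlier block of `ω`, at a position less than `M` and with denominator about
`R`, is repeated at the time when the denominator of the prefix of `ω` reaches `Z`. -/
def repeats (Z R : ℝ) (M : ℕ) : Set (ℕ → E) :=
  {ω | shift (S.level Z ω) ω ∈ S.recurring R M ω}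

lemma level_pow_le (hp : ∀ a, S.p a = 1 ∨ S.p a = -1) {Q : ℝ} (hQ0 : 0 ≤ Q) {b : ℕ}
    (hb : Q ≤ 2 ^ b) (k : ℕ) (ω : ℕ → E) : S.level (Q ^ k) ω ≤ b * k :=
  S.level_le <| (pow_le_pow_left₀ hQ0 hb k).trans <| by
    rw [← pow_mul]; exact S.two_pow_le_den hp ω _

lemma le_level_pow (hp : ∀ a, S.p a = 1 ∨ S.p a = -1) {Q : ℝ} (hQ : ∀ a, (S.q a : ℝ) ≤ Q)
    (k : ℕ) (ω : ℕ → E) : k ≤ S.level (Q ^ k) ω := by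
  have hQ1 : 1 < Q := by linarith [S.two_le_q hp (ω 0), hQ (ω 0)]
  by_contra! h
  have h1 := S.le_den_level hp (Q ^ k) ω
  have h2 : S.den ω (S.level (Q ^ k) ω) ≤ Q ^ S.level (Q ^ k) ω := by
    have : S.den ω (S.level (Q ^ k) ω) ≤ ∏ _i ∈ Finset.range (S.level (Q ^ k) ω), Q :=
      Finset.prod_le_prod (fun _ _ => Nat.cast_nonneg _) fun i _ => hQ (ω i)
    simpa using this
  have h3 := pow_lt_pow_right₀ hQ1 h
  linarith

lemma recurring_zero (R : ℝ) (ω : ℕ → E) : S.recurring R 0 ω = ∅ := by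
  ext η; simp [recurring]

lemma repeats_zero (Z R : ℝ) : S.repeats Z R 0 = ∅ := by
  ext ω; simp [repeats, recurring_zero]

/-- The event `repeats` is decided before the denominator of the prefix reaches
`Q ^ (k + l + 3)`. -/
lemma repeats_congr (hp : ∀ a, S.p a = 1 ∨ S.p a = -1) {Q : ℝ} (hQ : ∀ a, (S.q a : ℝ) ≤ Q) {b : ℕ}
    (hb : Q ≤ 2 ^ b) {k l M k' : ℕ} (hM : M + b * l ≤ k) (hk' : k + l + 3 ≤ k') {ω η : ℕ → E}
    (h : ∀ i < S.level (Q ^ k') ω, ω i = η i) (hω : ω ∈ S.repeats (Q ^ k) (Q ^ l) M) :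
    η ∈ S.repeats (Q ^ k) (Q ^ l) M := by
  have hQ1 : 1 < Q := by linarith [S.two_le_q hp (ω 0), hQ (ω 0)]
  obtain ⟨n, hn, hcyl⟩ := hω
  have hT' : S.level (Q ^ k) ω ≤ S.level (Q ^ k') ω :=
    S.level_mono hp (pow_le_pow_right₀ hQ1.le (by omega)) ω
  have hT : S.level (Q ^ k) ω = S.level (Q ^ k) η :=
    S.level_congr hp fun i hi => h i (hi.trans_le hT')
  have hkT : k ≤ S.level (Q ^ k) ω := S.le_level_pow hp hQ k ω
  set T := S.level (Q ^ k) ω with hTdef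
  set t := S.level (Q ^ l) (shift T ω) with ht
  have htb : t ≤ b * l := S.level_pow_le hp (by linarith) hb l _
  have hTt : T + t < S.level (Q ^ k') ω := by
    refine S.le_level_of_den_lt hp ?_
    rw [den_add]
    have h1 := S.den_level_le hp hQ (one_le_pow₀ hQ1.le (n := k)) ω
    have h2 := S.den_level_le hp hQ (one_le_pow₀ hQ1.le (n := l)) (shift T ω)
    calc S.den ω T * S.den (shift T ω) t ≤ (Q * Q ^ k) * (Q * Q ^ l) :=
          mul_le_mul h1 h2 (S.den_pos hp _ _).le (by positivity)
      _ = Q ^ (k + l + 2) := by ring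
      _ < Q ^ k' := pow_lt_pow_right₀ hQ1 (by omega)
  have hshift : ∀ i < t, shift T ω i = shift T η i := fun i hi => h (T + i) (by omega)
  have ht' : t = S.level (Q ^ l) (shift T η) := S.level_congr hp hshift
  refine ⟨n, hn, ?_⟩
  rw [← hT, ← ht']
  intro i hi
  rw [← hshift i hi, ← hcyl i hi]
  exact (h (n + i) (by omega)).symm

lemma measure_recurring_le [MeasurableSpace E] [MeasurableSingletonClass E]
    (hp : ∀ a, S.p a = 1 ∨ S.p a = -1) (m : Measure E) [IsProbabilityMeasure m] {s : ℝ} (hs : 0 < s)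
    (hm : ∀ a, m.real {a} = (S.q a : ℝ) ^ (-s)) {R : ℝ}
    (hR : 0 < R) (M : ℕ) (ω : ℕ → E) :
    (bernoulli m).real (S.recurring R M ω) ≤ min 1 (M * R ^ (-s)) := by
  refine le_min measureReal_le_one ?_
  have hsub : S.recurring R M ω ⊆ ⋃ n ∈ Finset.range M,
      PiNat.cylinder (shift n ω) (S.level R (shift n ω)) := by
    rintro η ⟨n, hn, hη⟩
    have h1 : ∀ i < S.level R η, η i = shift n ω i := fun i hi => (hη i hi).symm
    refine mem_iUnion₂.2 ⟨n, Finset.mem_range.2 hn, ?_⟩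
    rw [← S.level_congr hp h1]
    exact h1
  refine (measureReal_mono hsub (measure_ne_top _ _)).trans
    ((measureReal_biUnion_finset_le _ _).trans ?_)
  refine (Finset.sum_le_sum fun n _ =>
    S.bernoulli_real_cylinder_level_le m hm hp hs hR (shift n ω)).trans_eq ?_
  simp

variable [Finite E] [MeasurableSpace E] [MeasurableSingletonClass E]
  (hp : ∀ a, S.p a = 1 ∨ S.p a = -1)

include hp

lemma measurable_level (R : ℝ) : Measurable (S.level R) := by
  obtain ⟨N, hN⟩ := pow_unbounded_of_one_lt R (one_lt_two (α := ℝ))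
  refine measurable_of_dependsOn N fun ω η h => S.level_congr hp fun i hi => h i ?_
  exact hi.trans_le (S.level_le (hN.le.trans (S.two_pow_le_den hp ω N)))

lemma measurableSet_recurring (R : ℝ) (M : ℕ) :
    MeasurableSet {x : (ℕ → E) × (ℕ → E) | x.2 ∈ S.recurring R M x.1} := by
  have h : {x : (ℕ → E) × (ℕ → E) | x.2 ∈ S.recurring R M x.1}
      = ⋃ n : ℕ, ⋃ _ : n < M, ⋃ l : ℕ, {x | S.level R x.2 = l} ∩
        ⋂ i : ℕ, ⋂ _ : i < l, {x | x.1 (n + i) = x.2 i} := by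
    ext x
    simp only [recurring, mem_ofPred_eq, PiNat.mem_cylinder_iff, shift_apply, mem_iUnion,
      mem_inter_iff, mem_iInter]
    constructor
    · rintro ⟨n, hn, hx⟩
      exact ⟨n, hn, _, rfl, hx⟩
    · rintro ⟨n, hn, l, rfl, hx⟩
      exact ⟨n, hn, hx⟩
  rw [h]
  refine MeasurableSet.iUnion fun n => MeasurableSet.iUnion fun _ => MeasurableSet.iUnion fun l =>
    MeasurableSet.inter ?_ (MeasurableSet.iInter fun i => MeasurableSet.iInter fun _ => ?_)
  · exact ((S.measurable_level hp R).comp measurable_snd) (measurableSet_singleton l)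
  · have hf : Measurable fun x : (ℕ → E) × (ℕ → E) => (x.1 (n + i), x.2 i) :=
      ((measurable_pi_apply _).comp measurable_fst).prodMk
        ((measurable_pi_apply _).comp measurable_snd)
    exact hf ((toFinite (diagonal E)).measurableSet)

lemma measurableSet_recurring_apply (R : ℝ) (M : ℕ) (ω : ℕ → E) :
    MeasurableSet (S.recurring R M ω) :=
  measurable_prodMk_left (S.measurableSet_recurring hp R M)

lemma measurable_shift_level (Z : ℝ) : Measurable fun ω : ℕ → E => shift (S.level Z ω) ω := by
  refine measurable_pi_lambda _ fun i s hs => ?_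
  have : (fun ω : ℕ → E => shift (S.level Z ω) ω i) ⁻¹' s
      = ⋃ n : ℕ, S.level Z ⁻¹' {n} ∩ (fun ω => ω (n + i)) ⁻¹' s := by
    ext ω; simp [shift_apply]
  rw [this]
  exact MeasurableSet.iUnion fun n =>
    (S.measurable_level hp Z (measurableSet_singleton n)).inter (measurable_pi_apply _ hs)

lemma measurableSet_repeats (Z R : ℝ) (M : ℕ) : MeasurableSet (S.repeats Z R M) :=
  (measurable_id.prodMk (S.measurable_shift_level hp Z)) (S.measurableSet_recurring hp R M)

variable (m : Measure E) [IsProbabilityMeasure m]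

/-- By the strong Markov property, the conditional probability of a repetition given the past is the
measure of the set of recurring words. -/
lemma measure_inter_repeats {Q : ℝ} (hQ : ∀ a, (S.q a : ℝ) ≤ Q) {b : ℕ}
    (hb : Q ≤ 2 ^ b) {k l M : ℕ} (hM : M ≠ 0 → M + b * l ≤ k) {H : Set (ℕ → E)}
    (hH : MeasurableSet H)
    (hdep : ∀ ω η, (∀ i < S.level (Q ^ k) ω, ω i = η i) → (ω ∈ H ↔ η ∈ H)) :
    bernoulli m (H ∩ S.repeats (Q ^ k) (Q ^ l) M)
      = ∫⁻ ω in H, bernoulli m (S.recurring (Q ^ l) M ω) ∂bernoulli m := by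
  rcases eq_or_ne M 0 with rfl | hM0
  · simp [repeats_zero, recurring_zero]
  specialize hM hM0
  classical
  set F : (ℕ → E) → (ℕ → E) → ENNReal := fun ω η =>
    H.indicator 1 ω * (S.recurring (Q ^ l) M ω).indicator 1 η with hF
  have hFm : Measurable (Function.uncurry F) := by
    refine ((measurable_one.indicator hH).comp measurable_fst).mul ?_
    exact measurable_one.indicator (S.measurableSet_recurring hp (Q ^ l) M)
  have h := lintegral_shift_of_stopping m (S.measurable_level hp (Q ^ k))
    (fun ω η => S.level_congr hp) hFm (fun ω η hωη => by
      have h1 : ω ∈ H ↔ η ∈ H := hdep ω η hωη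
      have h2 : S.recurring (Q ^ l) M ω = S.recurring (Q ^ l) M η := by
        ext ζ
        have hQ0 : 0 ≤ Q := by linarith [S.two_le_q hp (ω 0), hQ (ω 0)]
        have hl := S.level_pow_le hp hQ0 hb l ζ
        have hk := S.le_level_pow hp hQ k ω
        refine exists_congr fun n => and_congr_right fun hn => ?_
        simp only [PiNat.mem_cylinder_iff, shift_apply]
        exact forall₂_congr fun i hi => by rw [hωη (n + i) (by omega)]
      funext ζ
      simp only [hF, h2]
      congr 1
      by_cases hx : ω ∈ H
      · simp [hx, h1.1 hx]
      · simp [hx, mt h1.2 hx])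
  have h1 : ∀ ω, F ω (shift (S.level (Q ^ k) ω) ω)
      = (H ∩ S.repeats (Q ^ k) (Q ^ l) M).indicator 1 ω := fun ω => by
    by_cases ha : ω ∈ H <;> by_cases hb : shift (S.level (Q ^ k) ω) ω ∈ S.recurring (Q ^ l) M ω <;>
      simp [hF, indicator, ha, hb, repeats]
  have h2 : ∀ ω, ∫⁻ η, F ω η ∂bernoulli m
      = H.indicator (fun ω => bernoulli m (S.recurring (Q ^ l) M ω)) ω := fun ω => by
    have hm := S.measurableSet_recurring_apply hp (Q ^ l) M ω
    rw [hF, lintegral_const_mul _ (measurable_one.indicator hm), lintegral_indicator_one hm]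
    by_cases hx : ω ∈ H <;> simp [hx]
  simp_rw [h1, h2] at h
  rwa [lintegral_indicator_one (hH.inter (S.measurableSet_repeats hp _ _ _)),
    lintegral_indicator hH] at h

variable {s : ℝ} (hs : 0 < s)

include hs in
/-- Averaging the second moment bound over the word to be found. -/
lemma le_lintegral_measure_recurring (hm : ∀ a, m.real {a} = (S.q a : ℝ) ^ (-s)) {Q : ℝ}
    (hQ0 : 0 < Q) (hQ : ∀ a, (S.q a : ℝ) ≤ Q) {R : ℝ} (hR : 1 ≤ R) (M : ℕ) :
    ENNReal.ofReal (Q ^ (-s) / (4 * (1 - 2 ^ (-s))⁻¹) * min 1 (M * R ^ (-s)))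
      ≤ ∫⁻ ω, bernoulli m (S.recurring R M ω) ∂bernoulli m := by
  set D : Set ((ℕ → E) × (ℕ → E)) := {x | x.2 ∈ S.recurring R M x.1} with hD
  have hDm : MeasurableSet D := S.measurableSet_recurring hp R M
  have h1 : ∫⁻ ω, bernoulli m (S.recurring R M ω) ∂bernoulli m
      = ∫⁻ η, bernoulli m {ω | η ∈ S.recurring R M ω} ∂bernoulli m := by
    have e1 := Measure.prod_apply (μ := bernoulli m) (ν := bernoulli m) hDm
    have e2 := Measure.prod_apply_symm (μ := bernoulli m) (ν := bernoulli m) hDm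
    exact e1.symm.trans e2
  rw [h1]
  have hθ1 : (2 : ℝ) ^ (-s) < 1 := Real.rpow_lt_one_of_one_lt_of_neg one_lt_two (by linarith)
  set κ : ℝ := 2 * (1 - 2 ^ (-s))⁻¹ with hκ
  have hκ0 : 0 < κ := by
    have : 0 < 1 - (2 : ℝ) ^ (-s) := by linarith
    positivity
  have hpt : ∀ η, ENNReal.ofReal (Q ^ (-s) / (4 * (1 - 2 ^ (-s))⁻¹) * min 1 (M * R ^ (-s)))
      ≤ bernoulli m {ω | η ∈ S.recurring R M ω} := by
    intro η
    rw [← ofReal_measureReal (measure_ne_top _ _)]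
    refine ENNReal.ofReal_le_ofReal ?_
    have h2 := le_measure_iUnion_shift_cylinder m (S.measureReal_singleton_le m hm hp hs) hθ1 η
      (S.level R η) M
    refine le_trans ?_ h2
    set p := (bernoulli m).real (PiNat.cylinder η (S.level R η)) with hpdef
    have hR0 : 0 < R := by linarith
    have hp1 : Q ^ (-s) * R ^ (-s) ≤ p := by
      rw [hpdef, S.bernoulli_real_cylinder_eq m hm, ← Real.mul_rpow hQ0.le hR0.le]
      exact Real.rpow_le_rpow_of_nonpos (S.den_pos hp _ _) (S.den_level_le hp hQ hR η)
        (by linarith)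
    have hp2 : p ≤ R ^ (-s) := S.bernoulli_real_cylinder_level_le m hm hp hs hR0 η
    have hp0 : 0 ≤ p := measureReal_nonneg
    set y : ℝ := M * R ^ (-s) with hy
    have hy0 : 0 ≤ y := by positivity
    have hyx : M * p ≤ y := by rw [hy]; gcongr
    have hq0 : 0 < Q ^ (-s) := Real.rpow_pos_of_pos hQ0 _
    have hxy : Q ^ (-s) * y ≤ M * p := by
      rw [hy]
      calc Q ^ (-s) * (M * R ^ (-s)) = M * (Q ^ (-s) * R ^ (-s)) := by ring
        _ ≤ M * p := by gcongr
    have hκ4 : 4 * (1 - (2 : ℝ) ^ (-s))⁻¹ = 2 * κ := by rw [hκ]; ring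
    have hx0 : 0 ≤ M * p := by positivity
    rw [hκ4, div_mul_eq_mul_div, div_le_div_iff₀ (by positivity) (by positivity)]
    have hmin : min 1 y * (1 + y) ≤ 2 * y := by
      rcases le_total 1 y with h | h
      · rw [min_eq_left h]; linarith
      · rw [min_eq_right h]; nlinarith
    have hmin0 : 0 ≤ min 1 y := le_min zero_le_one hy0
    calc Q ^ (-s) * min 1 y * (κ * (1 + M * p)) ≤ Q ^ (-s) * min 1 y * (κ * (1 + y)) := by gcongr
      _ = κ * Q ^ (-s) * (min 1 y * (1 + y)) := by ring
      _ ≤ κ * Q ^ (-s) * (2 * y) := by gcongr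
      _ = 2 * κ * (Q ^ (-s) * y) := by ring
      _ ≤ 2 * κ * (M * p) := by gcongr
      _ = M * p * (2 * κ) := by ring
  calc _ = ∫⁻ _η, ENNReal.ofReal (Q ^ (-s) / (4 * (1 - 2 ^ (-s))⁻¹) * min 1 (M * R ^ (-s)))
        ∂bernoulli m := by simp
    _ ≤ _ := lintegral_mono hpt

include hs in
/-- If the conditional probabilities of repetitions at a sparse sequence of scales have a divergent
sum, then some repetition occurs with a probability bounded below independently of the scales. -/
lemma le_measure_iUnion_repeats (hm : ∀ a, m.real {a} = (S.q a : ℝ) ^ (-s)) {Q : ℝ}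
    (hQ : ∀ a, (S.q a : ℝ) ≤ Q) (hQ1 : 1 < Q) {b : ℕ} (hb : Q ≤ 2 ^ b) (k l M : ℕ → ℕ)
    (hM : ∀ j, M j ≠ 0 → M j + b * l j ≤ k j) (hk : ∀ j, k j + l j + 3 ≤ k (j + 1))
    (hdiv : ¬ Summable fun j => min 1 ((M j : ℝ) * (Q ^ l j) ^ (-s))) :
    Q ^ (-s) / (4 * (1 - 2 ^ (-s))⁻¹)
      ≤ (bernoulli m).real (⋃ j, S.repeats (Q ^ k j) (Q ^ l j) (M j)) := by
  set C := Q ^ (-s) / (4 * (1 - (2 : ℝ) ^ (-s))⁻¹) with hC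
  set A : ℕ → Set (ℕ → E) := fun j => S.repeats (Q ^ k j) (Q ^ l j) (M j) with hA
  have hAm : ∀ j, MeasurableSet (A j) := fun j => S.measurableSet_repeats hp _ _ _
  set U : Set (ℕ → E) := ⋃ j, A j with hU
  have hUm : MeasurableSet U := MeasurableSet.iUnion hAm
  set g : ℕ → (ℕ → E) → ENNReal := fun j ω =>
    bernoulli m (S.recurring (Q ^ l j) (M j) ω) with hg
  have hgm : ∀ j, Measurable (g j) := fun j =>
    measurable_measure_prodMk_left (S.measurableSet_recurring hp _ _)
  set a : ℕ → ℝ := fun j => min 1 ((M j : ℝ) * (Q ^ l j) ^ (-s)) with ha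
  have ha0 : ∀ j, 0 ≤ a j := fun j => le_min zero_le_one (by positivity)
  have hga : ∀ j ω, g j ω ≤ ENNReal.ofReal (a j) := fun j ω => by
    change bernoulli m (S.recurring (Q ^ l j) (M j) ω) ≤ _
    rw [← ofReal_measureReal (measure_ne_top _ _)]
    exact ENNReal.ofReal_le_ofReal
      (S.measure_recurring_le hp m hs hm (by positivity) (M j) ω)
  have hglow : ∀ j, ENNReal.ofReal (C * a j) ≤ ∫⁻ ω, g j ω ∂bernoulli m := fun j =>
    S.le_lintegral_measure_recurring hp m hs hm (by linarith) hQ (one_le_pow₀ hQ1.le) (M j)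
  have hkmono : ∀ i j, i < j → k i + l i + 3 ≤ k j := by
    intro i j hij
    induction j, hij using Nat.le_induction with
    | base => exact hk i
    | succ j _ ih => have := hk j; omega
  -- `H j` is the event that no repetition has occurred before stage `j`.
  set H : ℕ → Set (ℕ → E) := fun j => ⋂ i, ⋂ _ : i < j, (A i)ᶜ with hH
  have hHm : ∀ j, MeasurableSet (H j) := fun j =>
    MeasurableSet.iInter fun i => MeasurableSet.iInter fun _ => (hAm i).compl
  have hHdep : ∀ j ω η, (∀ i < S.level (Q ^ k j) ω, ω i = η i) → (ω ∈ H j ↔ η ∈ H j) := by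
    intro j ω η h
    have hlev : S.level (Q ^ k j) ω = S.level (Q ^ k j) η := S.level_congr hp h
    simp only [hH, mem_iInter, mem_compl_iff]
    refine forall₂_congr fun i hi => not_congr ?_
    rcases eq_or_ne (M i) 0 with h0 | h0
    · simp [hA, h0, repeats_zero]
    · exact ⟨S.repeats_congr hp hQ hb (hM i h0) (hkmono i j hi) h,
        S.repeats_congr hp hQ hb (hM i h0) (hkmono i j hi)
          fun i' hi' => (h i' (by rwa [hlev])).symm⟩
  have hUH : ∀ j, Uᶜ ⊆ H j := fun j ω hω => by
    simp only [hH, mem_iInter, mem_compl_iff]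
    exact fun i _ hi => hω (mem_iUnion.2 ⟨i, hi⟩)
  have hfirst : ∀ j, ∫⁻ ω in Uᶜ, g j ω ∂bernoulli m ≤ bernoulli m (H j ∩ A j) := fun j => by
    rw [hA, S.measure_inter_repeats hp m hQ hb (hM j) (hHm j) (hHdep j)]
    exact lintegral_mono_set (hUH j)
  have hdisj : Pairwise (Function.onFun Disjoint fun j => H j ∩ A j) := by
    intro i j hij
    wlog h : i < j generalizing i j
    · exact (this hij.symm (lt_of_le_of_ne (not_lt.1 h) hij.symm)).symm
    · refine disjoint_left.2 fun ω hi hj => ?_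
      have := hj.1
      simp only [hH, mem_iInter] at this
      exact this i h hi.2
  have hmain : ∀ J, C * ∑ j ∈ Finset.range J, a j
      ≤ (∑ j ∈ Finset.range J, a j) * (bernoulli m).real U + 1 := by
    intro J
    have hsum0 : 0 ≤ ∑ j ∈ Finset.range J, a j := Finset.sum_nonneg fun j _ => ha0 j
    have h2 : (∑ j ∈ Finset.range J, ∫⁻ ω in Uᶜ, g j ω ∂bernoulli m) ≤ 1 := by
      calc _ ≤ ∑ j ∈ Finset.range J, bernoulli m (H j ∩ A j) :=
            Finset.sum_le_sum fun j _ => hfirst j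
        _ = bernoulli m (⋃ j ∈ Finset.range J, H j ∩ A j) :=
            (measure_biUnion_finset (hdisj.set_pairwise _) fun j _ => (hHm j).inter (hAm j)).symm
        _ ≤ 1 := prob_le_one
    have h3 : (∑ j ∈ Finset.range J, ∫⁻ ω in U, g j ω ∂bernoulli m)
        ≤ ENNReal.ofReal ((∑ j ∈ Finset.range J, a j) * (bernoulli m).real U) := by
      rw [Finset.sum_mul, ENNReal.ofReal_sum_of_nonneg fun j _ =>
        mul_nonneg (ha0 j) measureReal_nonneg]
      refine Finset.sum_le_sum fun j _ => ?_
      rw [ENNReal.ofReal_mul (ha0 j), ofReal_measureReal (measure_ne_top _ _)]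
      calc ∫⁻ ω in U, g j ω ∂bernoulli m ≤ ∫⁻ _ω in U, ENNReal.ofReal (a j) ∂bernoulli m :=
            lintegral_mono fun ω => hga j ω
        _ = _ := setLIntegral_const _ _
    have h4 : ENNReal.ofReal (C * ∑ j ∈ Finset.range J, a j)
        ≤ ∑ j ∈ Finset.range J, ∫⁻ ω, g j ω ∂bernoulli m := by
      have hC0 : 0 ≤ C := by
        have hθ1 : (2 : ℝ) ^ (-s) < 1 :=
          Real.rpow_lt_one_of_one_lt_of_neg one_lt_two (by linarith)
        have : 0 < 1 - (2 : ℝ) ^ (-s) := by linarith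
        rw [hC]; positivity
      rw [Finset.mul_sum, ENNReal.ofReal_sum_of_nonneg fun j _ => mul_nonneg hC0 (ha0 j)]
      exact Finset.sum_le_sum fun j _ => hglow j
    have h5 : ENNReal.ofReal (C * ∑ j ∈ Finset.range J, a j)
        ≤ ENNReal.ofReal ((∑ j ∈ Finset.range J, a j) * (bernoulli m).real U + 1) := by
      rw [ENNReal.ofReal_add (mul_nonneg hsum0 measureReal_nonneg) zero_le_one,
        ENNReal.ofReal_one]
      refine h4.trans ?_
      rw [Finset.sum_congr rfl fun j _ => (lintegral_add_compl (g j) hUm).symm,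
        Finset.sum_add_distrib]
      exact add_le_add h3 h2
    exact (ENNReal.ofReal_le_ofReal_iff (by positivity)).1 h5
  by_contra! hlt
  refine hdiv (summable_of_sum_range_le (c := (C - (bernoulli m).real U)⁻¹) ha0 fun J => ?_)
  rw [← one_div, le_div_iff₀ (by linarith)]
  linarith [hmain J]

end RationalIFS

/-! ### Series along blocks -/

section Blocks

lemma sum_range_blocks (f : ℕ → ℝ) {u : ℕ → ℕ} (hu : Monotone u) (J : ℕ) :
    ∑ j ∈ Finset.range J, ∑ n ∈ Finset.Ico (u j) (u (j + 1)), f n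
      = ∑ n ∈ Finset.Ico (u 0) (u J), f n := by
  induction J with
  | zero => simp
  | succ J ih =>
    rw [Finset.sum_range_succ, ih,
      Finset.sum_Ico_consecutive _ (hu (Nat.zero_le J)) (hu (Nat.le_succ J))]

lemma summable_of_sum_block_le {f g : ℕ → ℝ} (hf : ∀ n, 0 ≤ f n) (hg : Summable g)
    {u : ℕ → ℕ} (hu : StrictMono u)
    (h : ∀ j, ∑ n ∈ Finset.Ico (u j) (u (j + 1)), f n ≤ g j) : Summable f := by
  have hg0 : ∀ j, 0 ≤ g j := fun j => (Finset.sum_nonneg fun n _ => hf n).trans (h j)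
  refine summable_of_sum_range_le (c := ∑ n ∈ Finset.range (u 0), f n + ∑' j, g j) hf fun N => ?_
  calc ∑ n ∈ Finset.range N, f n ≤ ∑ n ∈ Finset.range (u N), f n :=
        Finset.sum_le_sum_of_subset_of_nonneg
          (Finset.range_subset_range.2 (hu.le_apply)) fun n _ _ => hf n
    _ = ∑ n ∈ Finset.range (u 0), f n + ∑ n ∈ Finset.Ico (u 0) (u N), f n :=
        (Finset.sum_range_add_sum_Ico _ (hu.monotone (Nat.zero_le N))).symm
    _ ≤ _ := by
        rw [← sum_range_blocks f hu.monotone N]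
        gcongr
        exact (Finset.sum_le_sum fun j _ => h j).trans (hg.sum_le_tsum _ fun j _ => hg0 j)

lemma summable_of_le_sum_block {f g : ℕ → ℝ} (hf : ∀ n, 0 ≤ f n) (hfs : Summable f)
    (hg : ∀ j, 0 ≤ g j) {u : ℕ → ℕ} (hu : Monotone u)
    (h : ∀ j, g j ≤ ∑ n ∈ Finset.Ico (u j) (u (j + 1)), f n) : Summable g := by
  refine summable_of_sum_range_le (c := ∑' n, f n) hg fun J => ?_
  refine (Finset.sum_le_sum fun j _ => h j).trans ?_
  rw [sum_range_blocks f hu J]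
  exact hfs.sum_le_tsum _ fun n _ => hf n

lemma summable_of_le_div_on_geometric_blocks {Q : ℕ} (hQ : 2 ≤ Q) {t g : ℕ → ℝ}
    (ht : ∀ n, 0 ≤ t n) (hg : Summable g) (hg0 : ∀ k, 0 ≤ g k) {K : ℕ}
    (h : ∀ k, K ≤ k → ∀ n : ℕ, Q ^ k ≤ n + 1 → n + 1 < Q ^ (k + 1) → t n ≤ g k / (n + 1)) :
    Summable t := by
  have hpos : ∀ k, 1 ≤ Q ^ k := fun k => Nat.one_le_pow _ _ (by omega)
  have hlt : ∀ k, Q ^ k < Q ^ (k + 1) := fun k => Nat.pow_lt_pow_right (by omega) (by omega)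
  have hu : StrictMono fun j => Q ^ (K + j) - 1 := strictMono_nat_of_lt_succ fun j => by
    have := hlt (K + j)
    have := hpos (K + j)
    simp only [← add_assoc]
    omega
  refine summable_of_sum_block_le (g := fun j => Q * g (K + j)) ht ?_ hu fun j => ?_
  · exact ((summable_nat_add_iff K).2 hg |>.congr fun j => by rw [add_comm]).mul_left _
  · have h1 : ∀ n ∈ Finset.Ico (Q ^ (K + j) - 1) (Q ^ (K + (j + 1)) - 1),
        t n ≤ g (K + j) / Q ^ (K + j) := by
      intro n hn
      rw [Finset.mem_Ico, ← add_assoc] at hn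
      have := hpos (K + j)
      refine (h (K + j) (by omega) n (by omega) (by omega)).trans ?_
      have h2 : ((Q ^ (K + j) : ℕ) : ℝ) ≤ ((n + 1 : ℕ) : ℝ) := by exact_mod_cast (by omega)
      push_cast at h2
      have h3 : (0 : ℝ) < (Q : ℝ) ^ (K + j) := by positivity
      have := hg0 (K + j)
      gcongr
    refine (Finset.sum_le_card_nsmul _ _ _ h1).trans ?_
    rw [nsmul_eq_mul, Nat.card_Ico]
    have h4 : ((Q ^ (K + (j + 1)) - 1 - (Q ^ (K + j) - 1) : ℕ) : ℝ) ≤ (Q : ℝ) ^ (K + j + 1) := by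
      have : Q ^ (K + (j + 1)) - 1 - (Q ^ (K + j) - 1) ≤ Q ^ (K + j + 1) := by
        rw [← add_assoc]; omega
      exact_mod_cast this
    have h3 : (0 : ℝ) < (Q : ℝ) ^ (K + j) := by positivity
    calc _ ≤ (Q : ℝ) ^ (K + j + 1) * (g (K + j) / Q ^ (K + j)) := by
          have := hg0 (K + j)
          gcongr
      _ = Q * g (K + j) := by rw [pow_succ]; field_simp

end Blocks

section Scales

/-- Scales `2 = k₀ < k₁ < …` whose gaps exceed the block lengths `l kⱼ` by three. -/
def sparseScale (l : ℕ → ℕ) : ℕ → ℕ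
  | 0 => 2
  | j + 1 => sparseScale l j + l (sparseScale l j) + 3

lemma add_two_le_sparseScale (l : ℕ → ℕ) (j : ℕ) : j + 2 ≤ sparseScale l j := by
  induction j with
  | zero => rfl
  | succ j ih => rw [sparseScale]; omega

lemma strictMono_sparseScale (l : ℕ → ℕ) : StrictMono (sparseScale l) :=
  strictMono_nat_of_lt_succ fun j => by rw [sparseScale]; omega

/-- The number of positions at which an earlier occurrence of a block of scale length `l k` is
looked for; it is zero if such blocks are too long compared with `k`. -/
def searchLength (b : ℕ) (l : ℕ → ℕ) (k : ℕ) : ℕ := if 2 * b * l k ≤ k then k / 2 else 0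

lemma searchLength_add_le {b : ℕ} {l : ℕ → ℕ} {k : ℕ} (h : searchLength b l k ≠ 0) :
    searchLength b l k + b * l k ≤ k := by
  unfold searchLength at h ⊢
  split_ifs at h ⊢ with h1
  · have : 2 * (b * l k) ≤ k := by rw [← mul_assoc]; exact h1
    omega
  · exact absurd rfl h

/-- Divergence over all scales with weight `1 / (1 + l k)` implies divergence along the sparse
scales. The scales at which `l k` is comparable to `k` contribute a convergent sum. -/
lemma not_summable_min_sparseScale {r : ℝ} (hr0 : 0 < r) (hr1 : r < 1) {b : ℕ} (hb : 1 ≤ b)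
    {l : ℕ → ℕ} (hl : Monotone l)
    (h : ¬ Summable fun k : ℕ => (k : ℝ) * r ^ l k / (1 + l k)) :
    ¬ Summable fun j => min 1 ((searchLength b l (sparseScale l j) : ℝ)
      * r ^ l (sparseScale l j)) := by
  intro hsum
  refine h ?_
  set k : ℕ → ℕ := sparseScale l with hk
  have hk2 : ∀ j, j + 2 ≤ k j := add_two_le_sparseScale l
  have hksucc : ∀ j, k (j + 1) = k j + l (k j) + 3 := fun j => rfl
  -- `v ^ (4 b) = r`
  set v : ℝ := r ^ (((4 * b : ℕ) : ℝ)⁻¹) with hv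
  have hv0 : 0 < v := Real.rpow_pos_of_pos hr0 _
  have hv1 : v < 1 := Real.rpow_lt_one hr0.le hr1 (by positivity)
  have hvr : v ^ (4 * b) = r := Real.rpow_inv_natCast_pow hr0.le (by omega)
  set w : ℝ := v ^ (2 * b) with hw
  have hw0 : 0 < w := pow_pos hv0 _
  have hw1 : w < 1 := pow_lt_one₀ hv0.le hv1 (by omega)
  obtain ⟨C, hC⟩ : ∃ C : ℝ, ∀ n : ℕ, ((2 * b + 1 : ℝ) * n + 3) * w ^ n ≤ C := by
    have h1 : Tendsto (fun n : ℕ => (2 * b + 1 : ℝ) * (n * w ^ n) + 3 * w ^ n) atTop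
        (𝓝 ((2 * b + 1 : ℝ) * 0 + 3 * 0)) :=
      ((tendsto_self_mul_const_pow_of_lt_one hw0.le hw1).const_mul _).add
        ((tendsto_pow_atTop_nhds_zero_of_lt_one hw0.le hw1).const_mul _)
    obtain ⟨C, hC⟩ := h1.bddAbove_range
    exact ⟨C, fun n => (le_of_eq (by ring)).trans (hC (mem_range_self n))⟩
  have hC0 : 0 ≤ C := le_trans (by positivity) (hC 0)
  set a : ℕ → ℝ := fun j => min 1 ((searchLength b l (k j) : ℝ) * r ^ l (k j)) with ha
  have ha0 : ∀ j, 0 ≤ a j := fun j => le_min zero_le_one (by positivity)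
  have hbound : Summable fun j => (k (j + 1) : ℝ) * r ^ l (k j) := by
    have hs2 : Summable fun j => 9 * a j + C * v ^ j :=
      (hsum.mul_left 9).add ((summable_geometric_of_lt_one hv0.le hv1).mul_left C)
    refine hs2.of_norm_bounded_eventually ?_
    rw [Nat.cofinite_eq_atTop]
    filter_upwards [(tendsto_order.1 hsum.tendsto_atTop_zero).2 1 one_pos] with j hj
    rw [Real.norm_of_nonneg (by positivity)]
    have hkj := hk2 j
    by_cases hgood : 2 * b * l (k j) ≤ k j
    · have hM : searchLength b l (k j) = k j / 2 := if_pos hgood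
      have haj : a j = (searchLength b l (k j) : ℝ) * r ^ l (k j) :=
        min_eq_right (le_of_lt (by
          rcases min_lt_iff.1 hj with h | h
          · exact absurd h (lt_irrefl _)
          · exact h))
      have h1 : l (k j) ≤ k j := by nlinarith
      have h2 : k (j + 1) ≤ 9 * searchLength b l (k j) := by rw [hksucc, hM]; omega
      have h3 : (k (j + 1) : ℝ) ≤ 9 * searchLength b l (k j) := by exact_mod_cast h2
      have h4 : 0 ≤ C * v ^ j := by positivity
      calc (k (j + 1) : ℝ) * r ^ l (k j) ≤ (9 * searchLength b l (k j)) * r ^ l (k j) := by gcongr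
        _ = 9 * a j := by rw [haj]; ring
        _ ≤ _ := by linarith
    · have h1 : r ^ l (k j) ≤ w ^ l (k j) * v ^ j := by
        rw [← hvr, hw, ← pow_mul, ← pow_mul, ← pow_add]
        refine pow_le_pow_of_le_one hv0.le hv1.le ?_
        have e : 4 * b * l (k j) = 2 * b * l (k j) + 2 * b * l (k j) := by ring
        omega
      have h2 : (k (j + 1) : ℝ) ≤ (2 * b + 1 : ℝ) * l (k j) + 3 := by
        have : k (j + 1) ≤ (2 * b + 1) * l (k j) + 3 := by
          rw [hksucc, add_mul, one_mul]; omega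
        exact_mod_cast this
      calc (k (j + 1) : ℝ) * r ^ l (k j)
          ≤ ((2 * b + 1 : ℝ) * l (k j) + 3) * (w ^ l (k j) * v ^ j) := by gcongr
        _ = (((2 * b + 1 : ℝ) * l (k j) + 3) * w ^ l (k j)) * v ^ j := by ring
        _ ≤ C * v ^ j := by gcongr; exact hC _
        _ ≤ _ := by have := ha0 j; linarith
  refine summable_of_sum_block_le (fun n => by positivity) (hbound.mul_left 3)
    (strictMono_sparseScale l) fun j => ?_
  have h1 : ∀ n ∈ Finset.Ico (k j) (k (j + 1)),
      (n : ℝ) * r ^ l n / (1 + l n) ≤ k (j + 1) * r ^ l (k j) / (1 + l (k j)) := by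
    intro n hn
    rw [Finset.mem_Ico] at hn
    have hln : l (k j) ≤ l n := hl hn.1
    have e1 : r ^ l n ≤ r ^ l (k j) := pow_le_pow_of_le_one hr0.le hr1.le hln
    have e2 : (n : ℝ) ≤ k (j + 1) := by exact_mod_cast hn.2.le
    gcongr
  refine (Finset.sum_le_card_nsmul _ _ _ h1).trans ?_
  rw [nsmul_eq_mul, Nat.card_Ico]
  have e3 : k (j + 1) - k j = l (k j) + 3 := by rw [hksucc]; omega
  rw [e3]
  have e4 : (((l (k j) + 3 : ℕ)) : ℝ) ≤ 3 * (1 + l (k j)) := by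
    push_cast
    have : (0 : ℝ) ≤ l (k j) := Nat.cast_nonneg _
    linarith
  have e5 : 0 ≤ (k (j + 1) : ℝ) * r ^ l (k j) := by positivity
  calc _ ≤ 3 * (1 + (l (k j) : ℝ)) * (k (j + 1) * r ^ l (k j) / (1 + l (k j))) := by gcongr
    _ = 3 * (k (j + 1) * r ^ l (k j)) := by field_simp

end Scales

section Scales

/-- Block lengths `l k`, in powers of `Q`, with `ψ(Qᵏ)⁻¹` of the order of `Q ^ l k`. -/
lemma exists_blockLength {ψ : ℝ → ℝ} (hψ_pos : ∀ t : ℝ, 0 < t → 0 < ψ t)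
    (hψ_anti : AntitoneOn ψ (Set.Ioi 0)) {Q : ℕ} (hQ : 2 ≤ Q) {A : ℝ} :
    ∃ (l : ℕ → ℕ) (B : ℝ), Monotone l ∧ (∀ k, A < ψ ((Q : ℝ) ^ k) * (Q : ℝ) ^ l k) ∧
      ∀ k, ψ ((Q : ℝ) ^ k) * (Q : ℝ) ^ l k ≤ B := by
  classical
  have hQ1 : (1 : ℝ) < Q := by exact_mod_cast (by omega : 1 < Q)
  have hQpos : ∀ k : ℕ, (0 : ℝ) < (Q : ℝ) ^ k := fun k => by positivity
  have hψk : ∀ k : ℕ, 0 < ψ ((Q : ℝ) ^ k) := fun k => hψ_pos _ (hQpos k)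
  have hanti : ∀ j k : ℕ, j ≤ k → ψ ((Q : ℝ) ^ k) ≤ ψ ((Q : ℝ) ^ j) := fun j k h =>
    hψ_anti (hQpos j) (hQpos k) (pow_le_pow_right₀ hQ1.le h)
  have hex : ∀ k : ℕ, ∃ n : ℕ, A < ψ ((Q : ℝ) ^ k) * (Q : ℝ) ^ n := fun k => by
    obtain ⟨n, hn⟩ := pow_unbounded_of_one_lt (A / ψ ((Q : ℝ) ^ k)) hQ1
    refine ⟨n, ?_⟩
    rw [div_lt_iff₀ (hψk k)] at hn
    linarith
  refine ⟨fun k => Nat.find (hex k), max (ψ 1) (A * Q), ?_, fun k => Nat.find_spec (hex k), ?_⟩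
  · intro j k hjk
    refine Nat.find_min' (hex j) ((Nat.find_spec (hex k)).trans_le ?_)
    have := hQpos (Nat.find (hex k))
    have := hanti j k hjk
    gcongr
  · intro k
    beta_reduce
    rcases Nat.eq_zero_or_pos (Nat.find (hex k)) with h | h
    · rw [h, pow_zero, mul_one]
      refine le_max_of_le_left ?_
      have := hanti 0 k (Nat.zero_le k)
      rwa [pow_zero] at this
    · refine le_max_of_le_right ?_
      obtain ⟨n, hn⟩ := Nat.exists_eq_succ_of_ne_zero h.ne'
      have h1 : ¬ (A < ψ ((Q : ℝ) ^ k) * (Q : ℝ) ^ n) := Nat.find_min (hex k) (by omega)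
      rw [hn, Nat.succ_eq_add_one, pow_succ, ← mul_assoc]
      exact mul_le_mul_of_nonneg_right (not_lt.1 h1) (by linarith)

/-- The divergence hypothesis in terms of the block lengths: `1 + l k` takes the place of
`|log ψ(Qᵏ)|`. -/
lemma not_summable_of_not_summable_log {ψ : ℝ → ℝ} (hψ_pos : ∀ t : ℝ, 0 < t → 0 < ψ t)
    (hψ_anti : AntitoneOn ψ (Set.Ioi 0)) {s : ℝ} (hs : 0 < s) {Q : ℕ} (hQ : 2 ≤ Q) {B : ℝ}
    {l : ℕ → ℕ} (hl : Monotone l) (hB : ∀ k, ψ ((Q : ℝ) ^ k) * (Q : ℝ) ^ l k ≤ B)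
    (h : ¬ Summable fun n : ℕ =>
      Real.log (n + 1) * ψ (n + 1) ^ s / ((n + 1) * Real.log (ψ (n + 1)))) :
    ¬ Summable fun k : ℕ => (k : ℝ) * ((Q : ℝ) ^ (-s)) ^ l k / (1 + l k) := by
  intro hG
  refine h ?_
  have hQ1 : (1 : ℝ) < Q := by exact_mod_cast (by omega : 1 < Q)
  have hQ0 : (0 : ℝ) < Q := by linarith
  have hQpos : ∀ k : ℕ, (0 : ℝ) < (Q : ℝ) ^ k := fun k => by positivity
  have hψk : ∀ k : ℕ, 0 < ψ ((Q : ℝ) ^ k) := fun k => hψ_pos _ (hQpos k)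
  have hB0 : 0 < B := lt_of_lt_of_le (mul_pos (hψk 0) (hQpos _)) (hB 0)
  set r : ℝ := (Q : ℝ) ^ (-s) with hr
  have hr0 : 0 < r := Real.rpow_pos_of_pos hQ0 _
  have hr1 : r < 1 := Real.rpow_lt_one_of_one_lt_of_neg hQ1 (by linarith)
  have hlog : 0 < Real.log Q := Real.log_pos hQ1
  -- If `ψ` does not tend to zero, the terms of the sum over scales do not tend to zero.
  have hlinf : Tendsto l atTop atTop := by
    refine tendsto_atTop_atTop_of_monotone hl fun L => ?_
    by_contra! hL
    have hlow : ∀ k : ℕ, 1 ≤ k → r ^ L / (1 + L) ≤ (k : ℝ) * r ^ l k / (1 + l k) := by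
      intro k hk
      have e1 : r ^ L ≤ r ^ l k := pow_le_pow_of_le_one hr0.le hr1.le (hL k).le
      have e2 : (l k : ℝ) ≤ L := by exact_mod_cast (hL k).le
      have e3 : (1 : ℝ) ≤ k := by exact_mod_cast hk
      have e4 : r ^ L ≤ k * r ^ l k := e1.trans (le_mul_of_one_le_left (by positivity) e3)
      gcongr
    have h0 : r ^ L / (1 + L) ≤ 0 := ge_of_tendsto hG.tendsto_atTop_zero (by
      filter_upwards [eventually_ge_atTop 1] with k hk using hlow k hk)
    have : 0 < r ^ L / (1 + L) := by positivity
    linarith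
  have hev : ∀ᶠ k in atTop, Real.log B ≤ l k * (Real.log Q / 2) ∧ 1 ≤ l k ∧ 1 ≤ k := by
    have h1 : Tendsto (fun k => (l k : ℝ) * (Real.log Q / 2)) atTop atTop :=
      (tendsto_natCast_atTop_atTop.comp hlinf).atTop_mul_const (by positivity)
    exact (h1.eventually_ge_atTop _).and
      ((hlinf.eventually_ge_atTop 1).and (eventually_ge_atTop 1))
  obtain ⟨K, hK⟩ := eventually_atTop.1 hev
  refine Summable.of_norm (summable_of_le_div_on_geometric_blocks hQ (fun n => norm_nonneg _)
    (hG.mul_left (8 * B ^ s)) (fun k => by positivity) (K := K) ?_)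
  intro k hk n hn1 hn2
  obtain ⟨hk1, hk2, hk3⟩ := hK k hk
  have hn1' : (Q : ℝ) ^ k ≤ n + 1 := by exact_mod_cast hn1
  have hn2' : (n + 1 : ℝ) ≤ (Q : ℝ) ^ (k + 1) := by exact_mod_cast hn2.le
  have hn0 : (0 : ℝ) < n + 1 := by positivity
  set x := ψ (n + 1) with hx
  have hx0 : 0 < x := hψ_pos _ hn0
  have hxf : x ≤ ψ ((Q : ℝ) ^ k) := hψ_anti (hQpos k) hn0 hn1'
  have hxB : x ≤ B / (Q : ℝ) ^ l k := by
    rw [le_div_iff₀ (hQpos _)]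
    exact (mul_le_mul_of_nonneg_right hxf (hQpos _).le).trans (hB k)
  have hlogx : Real.log x ≤ Real.log B - l k * Real.log Q := by
    refine (Real.log_le_log hx0 hxB).trans_eq ?_
    rw [Real.log_div hB0.ne' (hQpos _).ne', Real.log_pow]
  have hlk : (1 : ℝ) ≤ l k := by exact_mod_cast hk2
  have habs : (1 + l k) * (Real.log Q / 4) ≤ |Real.log x| := by
    rw [abs_of_nonpos (by nlinarith)]
    nlinarith
  have hxs : x ^ s ≤ B ^ s * r ^ l k := by
    refine (Real.rpow_le_rpow hx0.le hxB hs.le).trans_eq ?_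
    rw [Real.div_rpow hB0.le (hQpos _).le, hr, Real.rpow_pow_comm hQ0.le,
      Real.rpow_neg (hQpos _).le]
    rfl
  have hlogn : Real.log (n + 1) ≤ 2 * k * Real.log Q := by
    refine (Real.log_le_log hn0 hn2').trans ?_
    rw [Real.log_pow]
    have : (1 : ℝ) ≤ k := by exact_mod_cast hk3
    push_cast
    nlinarith
  have hlogn0 : 0 ≤ Real.log (n + 1) := Real.log_nonneg (by
    have : (0 : ℝ) ≤ n := Nat.cast_nonneg n
    linarith)
  have hxs0 : 0 ≤ x ^ s := by positivity
  rw [norm_div, norm_mul, norm_mul, Real.norm_eq_abs, Real.norm_eq_abs, Real.norm_eq_abs,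
    Real.norm_eq_abs, abs_of_nonneg hlogn0, abs_of_nonneg hxs0, abs_of_pos hn0]
  calc Real.log (n + 1) * x ^ s / ((n + 1) * |Real.log x|)
      ≤ (2 * k * Real.log Q) * (B ^ s * r ^ l k)
        / ((n + 1) * ((1 + l k) * (Real.log Q / 4))) := by gcongr
    _ = 8 * B ^ s * (k * r ^ l k / (1 + l k)) / (n + 1) := by field_simp; ring

end Scales

/-! ### Divergence: almost every point is well approximable -/

namespace RationalIFS

open Words

variable {E : Type*} (S : RationalIFS E)

/-- The words `ω` such that `S.coding ω` is within `ε ψ(D) / D` of a point coded by an eventually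
periodic word, where `D` is the denominator of the preperiod followed by a period. The set is
defined by this denominator, which is comparable with the intrinsic one. -/
def approxWords (ψ : ℝ → ℝ) (ε : ℝ) : Set (ℕ → E) :=
  {ω | ∃ (η : ℕ → E) (n m : ℕ), IsPeriodFrom η n m ∧
    |S.coding ω - S.coding η| < ε * (ψ (S.den η (n + m)) / S.den η (n + m))}

/-- The words coding points that are well approximable with respect to the denominators used in
`approxWords`. -/
def wellApproxWords (ψ : ℝ → ℝ) : Set (ℕ → E) := ⋂ i : ℕ, S.approxWords ψ (1 / (i + 1))

variable (hp : ∀ a, S.p a = 1 ∨ S.p a = -1) {ψ : ℝ → ℝ} (hψ_pos : ∀ t : ℝ, 0 < t → 0 < ψ t)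

include hp hψ_pos

lemma approxWords_mono {ε ε' : ℝ} (h : ε ≤ ε') : S.approxWords ψ ε ⊆ S.approxWords ψ ε' := by
  rintro ω ⟨η, n, m, hper, hlt⟩
  refine ⟨η, n, m, hper, hlt.trans_le ?_⟩
  have hD := S.den_pos hp η (n + m)
  have := hψ_pos _ hD
  gcongr

lemma mem_approxWords_of_mem {ω : ℕ → E} (h : ω ∈ S.wellApproxWords ψ) {ε : ℝ} (hε : 0 < ε) :
    ω ∈ S.approxWords ψ ε := by
  obtain ⟨i, hi⟩ := exists_nat_one_div_lt hε
  exact S.approxWords_mono hp hψ_pos hi.le (mem_iInter.1 h i)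

lemma wellSymbApprox_of_mem [Finite E] (hψ_anti : AntitoneOn ψ (Set.Ioi 0))
    (hψ_slow : SlowlyVarying ψ) {ω : ℕ → E} (h : ω ∈ S.wellApproxWords ψ) :
    S.WellSymbApprox ψ (S.coding ω) := by
  refine ⟨mem_range_self ω, ?_⟩
  rintro ⟨-, ε, hε, hbad⟩
  obtain ⟨C, hC, hψC⟩ := hψ_slow 2 two_pos
  obtain ⟨η, n, m, hper, hlt⟩ := S.mem_approxWords_of_mem hp hψ_pos h
    (ε := ε / (2 * C)) (by positivity)
  obtain ⟨y, hy⟩ := S.exists_rat_eq_coding hp hper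
  have hep : EventuallyPeriodic η := ⟨n, m, hper⟩
  have h1 := hbad y (hy ▸ mem_range_self η) (S.intDenomWord η) ⟨η, hep, hy.symm, rfl⟩
  rw [hy] at h1
  have hN0 : (0 : ℝ) < S.intDenomWord η :=
    lt_of_lt_of_le (half_pos (S.den_pos hp η _)) (S.le_intDenomWord hp hep)
  have hN := S.intDenomWord_le hp hper
  set D := S.den η (n + m) with hD
  have hD0 : 0 < D := S.den_pos hp η _
  set N : ℝ := (S.intDenomWord η : ℝ)
  have h2 : ψ D / (C * (2 * D)) ≤ ψ N / N := by
    have e1 : ψ (2 * D) ≤ ψ N := hψ_anti hN0 (show (0 : ℝ) < 2 * D by positivity) hN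
    have e2 : ψ D / C ≤ ψ N := by
      rw [div_le_iff₀ hC, mul_comm]
      exact (hψC D hD0).2.trans (by gcongr)
    rw [← div_div]
    have := hψ_pos N hN0
    gcongr
  have h3 : ε / (2 * C) * (ψ D / D) = ε * (ψ D / (C * (2 * D))) := by field_simp
  have h4 : ε * (ψ D / (C * (2 * D))) ≤ ε * (ψ N / N) := by gcongr
  linarith

lemma cons_mem_wellApproxWords [Finite E] (hψ_slow : SlowlyVarying ψ) {ω : ℕ → E}
    (h : ω ∈ S.wellApproxWords ψ) (a : E) : cons a ω ∈ S.wellApproxWords ψ := by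
  refine mem_iInter.2 fun i => ?_
  have hq : (0 : ℝ) < S.q a := by linarith [S.two_le_q hp a]
  obtain ⟨C, hC, hψC⟩ := hψ_slow (S.q a) hq
  set ε : ℝ := 1 / (i + 1) with hε
  have hε0 : 0 < ε := by positivity
  obtain ⟨η, n, m, hper, hlt⟩ := S.mem_approxWords_of_mem hp hψ_pos h (ε := ε / C) (by positivity)
  refine ⟨cons a η, n + 1, m, ⟨hper.1, fun j => ?_⟩, ?_⟩
  · rw [show n + 1 + j + m = (n + j + m) + 1 by ring, show n + 1 + j = (n + j) + 1 by ring,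
      cons_succ, cons_succ, hper.2]
  · rw [coding_cons, coding_cons, S.abs_u_sub hp, show n + 1 + m = (n + m) + 1 by ring, den_cons]
    set D := S.den η (n + m) with hD
    have hD0 : 0 < D := S.den_pos hp η _
    rw [div_lt_iff₀ hq]
    refine hlt.trans_le ?_
    have e1 : ψ D / C ≤ ψ (S.q a * D) := by
      rw [div_le_iff₀ hC, mul_comm]
      exact (hψC D hD0).2
    calc ε / C * (ψ D / D) = ε * ((ψ D / C) / D) := by field_simp
      _ ≤ ε * (ψ (S.q a * D) / D) := by gcongr
      _ = ε * (ψ (S.q a * D) / (S.q a * D)) * S.q a := by field_simp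

omit hψ_pos in
/-- A repetition of a block gives a good approximation: the word is approximated by the
continuation of its prefix that is periodic from the first occurrence of the block on. -/
lemma repeats_subset_approxWords [Finite E] (hψ_anti : AntitoneOn ψ (Set.Ioi 0)) {c d : ℝ}
    (hcd : c ≤ d) (hmap : ∀ a, S.u a '' Icc c d ⊆ Icc c d) {Q : ℝ} (hQ : ∀ a, (S.q a : ℝ) ≤ Q)
    (hQ1 : 1 < Q) {b : ℕ} (hb : Q ≤ 2 ^ b) {C : ℝ} (hC : 0 < C)
    (hψC : ∀ t : ℝ, 0 < t → ψ t ≤ C * ψ (Q * t)) {ε : ℝ} (hε : 0 < ε) {k l M : ℕ}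
    (hM : M + b * l ≤ k) (hkl : (d - c) * C / ε < ψ (Q ^ k) * Q ^ l) :
    S.repeats (Q ^ k) (Q ^ l) M ⊆ S.approxWords ψ ε := by
  rintro ω ⟨n, hn, hcyl⟩
  have hkT : k ≤ S.level (Q ^ k) ω := S.le_level_pow hp hQ k ω
  have hden := S.den_level_le hp hQ (one_le_pow₀ hQ1.le (n := k)) ω
  set T := S.level (Q ^ k) ω with hT
  have htb : S.level (Q ^ l) (shift T ω) ≤ b * l := S.level_pow_le hp (by linarith) hb l _
  have hdent := S.le_den_level hp (Q ^ l) (shift T ω)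
  set t := S.level (Q ^ l) (shift T ω) with ht
  set η : ℕ → E := fun i => if i < n then ω i else ω (n + (i - n) % (T - n)) with hη
  have hηT : ∀ i < T, η i = ω i := by
    intro i hi
    simp only [hη]
    split_ifs with h
    · rfl
    · rw [Nat.mod_eq_of_lt (by omega)]
      congr 1; omega
  have hper : IsPeriodFrom η n (T - n) := by
    refine ⟨by omega, fun i => ?_⟩
    simp only [hη]
    rw [if_neg (by omega), if_neg (by omega), show n + i + (T - n) - n = i + (T - n) by omega,
      Nat.add_mod_right, Nat.add_sub_cancel_left]
  have hagree : ∀ i < T + t, ω i = η i := by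
    intro i hi
    rcases lt_or_ge i T with h | h
    · exact (hηT i h).symm
    · obtain ⟨j, rfl⟩ := Nat.exists_eq_add_of_le h
      have hj : j < t := by omega
      simp only [hη]
      rw [if_neg (by omega), show T + j - n = j + (T - n) by omega, Nat.add_mod_right,
        Nat.mod_eq_of_lt (by omega)]
      exact (hcyl j hj).symm
  refine ⟨η, n, T - n, hper, ?_⟩
  rw [show n + (T - n) = T by omega, S.den_congr hηT]
  have hQk : (0 : ℝ) < Q ^ k := by positivity
  have hD0 := S.den_pos hp ω T
  refine (S.abs_coding_sub_le hp hmap hcd hagree).trans_lt ?_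
  rw [den_add]
  set D := S.den ω T with hD
  have h1 : ψ (Q ^ k) ≤ C * ψ D := (hψC _ hQk).trans (by
    gcongr
    exact hψ_anti hD0 (show (0 : ℝ) < Q * Q ^ k by positivity) hden)
  have hQl : (0 : ℝ) < Q ^ l := by positivity
  have h2 : (d - c) * C < ε * (ψ (Q ^ k) * Q ^ l) := by
    rw [div_lt_iff₀ hε] at hkl
    linarith
  have h3 : d - c < ε * (ψ D * Q ^ l) := by
    have : ε * (ψ (Q ^ k) * Q ^ l) ≤ ε * (C * ψ D * Q ^ l) := by gcongr
    have h4 : (d - c) * C < ε * (ψ D * Q ^ l) * C := by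
      calc _ < _ := h2
        _ ≤ _ := this
        _ = _ := by ring
    exact lt_of_mul_lt_mul_right h4 hC.le
  have h5 : 0 ≤ d - c := by linarith
  calc (d - c) / (D * S.den (shift T ω) t) ≤ (d - c) / (D * Q ^ l) := by gcongr
    _ < ε * (ψ D * Q ^ l) / (D * Q ^ l) := by gcongr
    _ = ε * (ψ D / D) := by field_simp

omit hp hψ_pos in
lemma isOpen_approxWords [TopologicalSpace E] (hcont : Continuous S.coding) (ε : ℝ) :
    IsOpen (S.approxWords ψ ε) := by
  have : S.approxWords ψ ε = ⋃ (η : ℕ → E) (n : ℕ) (m : ℕ) (_ : IsPeriodFrom η n m),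
      {ω | |S.coding ω - S.coding η| < ε * (ψ (S.den η (n + m)) / S.den η (n + m))} := by
    ext ω; simp [approxWords]
  rw [this]
  exact isOpen_iUnion fun η => isOpen_iUnion fun n => isOpen_iUnion fun m => isOpen_iUnion fun _ =>
    isOpen_lt (by fun_prop) continuous_const

/-- Almost every word codes a well approximable point: the probability of `approxWords` is bounded
below uniformly in `ε`, and `wellApproxWords` obeys a zero-one law. -/
lemma ae_mem_wellApproxWords [Finite E] [TopologicalSpace E] [DiscreteTopology E]
    [MeasurableSpace E] [BorelSpace E] (hψ_anti : AntitoneOn ψ (Set.Ioi 0))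
    (hψ_slow : SlowlyVarying ψ) {c d : ℝ} (hcd : c ≤ d)
    (hmap : ∀ a, S.u a '' Icc c d ⊆ Icc c d) (m : Measure E) [IsProbabilityMeasure m] {s : ℝ}
    (hs : 0 < s) (hm : ∀ a, m.real {a} = (S.q a : ℝ) ^ (-s))
    (h : ¬ Summable fun n : ℕ =>
      Real.log (n + 1) * ψ (n + 1) ^ s / ((n + 1) * Real.log (ψ (n + 1)))) :
    ∀ᵐ ω ∂bernoulli m, ω ∈ S.wellApproxWords ψ := by
  have := Fintype.ofFinite E
  have hcont : Continuous S.coding := S.continuous_coding hp hmap hcd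
  obtain ⟨Q, hQ2, hQ⟩ : ∃ Q : ℕ, 2 ≤ Q ∧ ∀ a, (S.q a : ℝ) ≤ Q := by
    refine ⟨max 2 (Finset.univ.sup S.q), le_max_left _ _, fun a => ?_⟩
    exact_mod_cast (Finset.le_sup (f := S.q) (Finset.mem_univ a)).trans (le_max_right _ _)
  have hQ1 : (1 : ℝ) < Q := by exact_mod_cast (by omega : 1 < Q)
  obtain ⟨b, hb1, hb⟩ : ∃ b : ℕ, 1 ≤ b ∧ (Q : ℝ) ≤ 2 ^ b :=
    ⟨Q, by omega, by exact_mod_cast Nat.lt_two_pow_self.le⟩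
  obtain ⟨C, hC, hψC⟩ := hψ_slow Q (by linarith)
  set c₀ : ℝ := (Q : ℝ) ^ (-s) / (4 * (1 - 2 ^ (-s))⁻¹) with hc₀
  have hc₀0 : 0 < c₀ := by
    have hθ1 : (2 : ℝ) ^ (-s) < 1 := Real.rpow_lt_one_of_one_lt_of_neg one_lt_two (by linarith)
    have : 0 < 1 - (2 : ℝ) ^ (-s) := by linarith
    positivity
  have hlow : ∀ ε : ℝ, 0 < ε → c₀ ≤ (bernoulli m).real (S.approxWords ψ ε) := by
    intro ε hε
    obtain ⟨l, B, hl, hA, hB⟩ := exists_blockLength hψ_pos hψ_anti hQ2 (A := (d - c) * C / ε)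
    have h1 := not_summable_of_not_summable_log hψ_pos hψ_anti hs hQ2 hl hB h
    have h2 := not_summable_min_sparseScale (Real.rpow_pos_of_pos (by linarith) _)
      (Real.rpow_lt_one_of_one_lt_of_neg hQ1 (by linarith)) hb1 hl h1
    simp_rw [Real.rpow_pow_comm (by linarith : (0 : ℝ) ≤ Q)] at h2
    have h3 := S.le_measure_iUnion_repeats hp m hs hm hQ hQ1 hb (sparseScale l)
      (fun j => l (sparseScale l j)) (fun j => searchLength b l (sparseScale l j))
      (fun j => searchLength_add_le) (fun j => le_rfl) h2
    refine h3.trans (measureReal_mono (iUnion_subset fun j => ?_))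
    rcases eq_or_ne (searchLength b l (sparseScale l j)) 0 with h0 | h0
    · rw [h0, repeats_zero]; exact empty_subset _
    · exact S.repeats_subset_approxWords hp hψ_anti hcd hmap hQ hQ1 hb hC
        (fun t ht => (hψC t ht).2) hε (searchLength_add_le h0) (hA _)
  have hmeas : ∀ ε, MeasurableSet (S.approxWords ψ ε) := fun ε =>
    (S.isOpen_approxWords hcont ε).measurableSet
  have hWm : MeasurableSet (S.wellApproxWords ψ) := MeasurableSet.iInter fun i => hmeas _
  have hWlow : ENNReal.ofReal c₀ ≤ bernoulli m (S.wellApproxWords ψ) := by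
    have hanti : Antitone fun i : ℕ => S.approxWords ψ (1 / (i + 1)) := fun i j hij => by
      refine S.approxWords_mono hp hψ_pos ?_
      have : (i : ℝ) ≤ j := by exact_mod_cast hij
      gcongr
    have hlim := tendsto_measure_iInter_atTop (μ := bernoulli m)
      (fun i => (hmeas (1 / ((i : ℕ) + 1))).nullMeasurableSet) hanti ⟨0, measure_ne_top _ _⟩
    refine ge_of_tendsto' hlim fun i => ?_
    rw [Function.comp_apply, ← ofReal_measureReal (measure_ne_top _ _)]
    exact ENNReal.ofReal_le_ofReal (hlow _ (by positivity))
  have hsub : (S.wellApproxWords ψ)ᶜ ⊆ shift 1 ⁻¹' (S.wellApproxWords ψ)ᶜ := by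
    intro ω hω hω'
    refine hω ?_
    rw [← cons_shift_one ω]
    exact S.cons_mem_wellApproxWords hp hψ_pos hψ_slow hω' (ω 0)
  rcases measure_eq_zero_or_one_of_subset_shift_preimage m hWm.compl hsub with h0 | h1
  · exact h0
  · rw [prob_compl_eq_one_iff hWm] at h1
    rw [h1, nonpos_iff_eq_zero, ENNReal.ofReal_eq_zero] at hWlow
    linarith

end RationalIFS

/-! ### Convergence: almost every point is badly approximable -/

/-- The convergence hypothesis in terms of word lengths. -/
lemma summable_length_mul_of_summable_log {ψ : ℝ → ℝ} (hψ_pos : ∀ t : ℝ, 0 < t → 0 < ψ t)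
    (hψ_anti : AntitoneOn ψ (Set.Ioi 0)) {s : ℝ} (hs : 0 < s)
    (h : Summable fun n : ℕ => Real.log (n + 1) * ψ (n + 1) ^ s / (n + 1)) :
    Summable fun j : ℕ => (j : ℝ) * ψ (2 ^ j / 2) ^ s := by
  have hlog : 0 < Real.log 2 := Real.log_pos one_lt_two
  have hψn : ∀ n : ℕ, 0 < ψ (n + 1) := fun n => hψ_pos _ (by positivity)
  have hψk : ∀ k : ℕ, 0 < ψ (2 ^ k) := fun n => hψ_pos _ (by positivity)
  have hlogn : ∀ n : ℕ, 0 ≤ Real.log ((n : ℝ) + 1) := fun n => Real.log_nonneg (by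
    have : (0 : ℝ) ≤ n := Nat.cast_nonneg n
    linarith)
  have hpos : ∀ k : ℕ, (1 : ℕ) ≤ 2 ^ k := fun k => Nat.one_le_two_pow
  have hu : Monotone fun k : ℕ => (2 ^ k - 1 : ℕ) := fun j k hjk =>
    Nat.sub_le_sub_right (Nat.pow_le_pow_right two_pos hjk) 1
  have h1 : Summable fun k : ℕ => (k * Real.log 2) * ψ (2 ^ (k + 1)) ^ s / 2 := by
    refine summable_of_le_sum_block (fun n => ?_) h (fun k => ?_) hu fun k => ?_
    · have := hlogn n
      have := hψn n
      positivity
    · have := hψk (k + 1)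
      positivity
    · have h2 : ∀ n ∈ Finset.Ico (2 ^ k - 1 : ℕ) (2 ^ (k + 1) - 1),
          (k * Real.log 2) * ψ (2 ^ (k + 1)) ^ s / 2 ^ (k + 1)
            ≤ Real.log (n + 1) * ψ (n + 1) ^ s / (n + 1) := by
        intro n hn
        rw [Finset.mem_Ico] at hn
        have := hpos k
        have e1 : (2 : ℝ) ^ k ≤ n + 1 := by
          exact_mod_cast (by omega : 2 ^ k ≤ n + 1)
        have e2 : (n + 1 : ℝ) ≤ 2 ^ (k + 1) := by
          exact_mod_cast (by omega : n + 1 ≤ 2 ^ (k + 1))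
        have e3 : k * Real.log 2 ≤ Real.log (n + 1) := by
          rw [← Real.log_pow]
          exact Real.log_le_log (by positivity) e1
        have e4 : ψ (2 ^ (k + 1)) ≤ ψ (n + 1) :=
          hψ_anti (show (0 : ℝ) < n + 1 by positivity) (show (0 : ℝ) < 2 ^ (k + 1) by positivity) e2
        have e5 : ψ (2 ^ (k + 1)) ^ s ≤ ψ (n + 1) ^ s := Real.rpow_le_rpow (hψk _).le e4 hs.le
        have e6 : 0 ≤ ψ (2 ^ (k + 1)) ^ s := Real.rpow_nonneg (hψk _).le _
        have e7 := mul_nonneg (hlogn n) (e6.trans e5)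
        have e8 := hlogn n
        gcongr
      refine le_trans (le_of_eq ?_) (Finset.card_nsmul_le_sum _ _ _ h2)
      have e8 : (2 : ℕ) ^ (k + 1) - 1 - (2 ^ k - 1) = 2 ^ k := by
        have := hpos k
        rw [pow_succ]; omega
      rw [nsmul_eq_mul, Nat.card_Ico, e8]
      push_cast
      rw [pow_succ]
      field_simp
  rw [← summable_nat_add_iff 3]
  have h3 := ((summable_nat_add_iff 1).2 h1).mul_left (6 / Real.log 2)
  refine Summable.of_nonneg_of_le (fun k => ?_) (fun k => ?_) h3
  · have : 0 < ψ (2 ^ (k + 3) / 2) := hψ_pos _ (by positivity)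
    positivity
  · have e1 : (2 : ℝ) ^ (k + 3) / 2 = 2 ^ (k + 1 + 1) := by ring
    have e2 : 0 ≤ ψ (2 ^ (k + 1 + 1)) ^ s := Real.rpow_nonneg (hψk _).le _
    rw [e1]
    push_cast
    calc ((k : ℝ) + 3) * ψ (2 ^ (k + 1 + 1)) ^ s
        ≤ (3 * (k + 1)) * ψ (2 ^ (k + 1 + 1)) ^ s := by
          have : (0 : ℝ) ≤ k := Nat.cast_nonneg k
          gcongr
          linarith
      _ = _ := by field_simp; ring

namespace Words

variable {E : Type*}

/-- The word that starts with the letters of `γ` and repeats those from position `n` on forever. -/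
def periodicExtension {j : ℕ} (γ : Fin j → E) (n : Fin j) (i : ℕ) : E :=
  if h : i < j then γ ⟨i, h⟩
  else γ ⟨n + (i - n) % (j - n), by have := Nat.mod_lt (i - n) (Nat.sub_pos_of_lt n.2); omega⟩

lemma periodicExtension_of_isPeriodFrom {ω : ℕ → E} {n m : ℕ} (h : IsPeriodFrom ω n m) :
    periodicExtension (fun i : Fin (n + m) => ω i) ⟨n, Nat.lt_add_of_pos_right h.1⟩ = ω := by
  funext i
  unfold periodicExtension
  split_ifs with hi
  · rfl
  · have e : n + m - n = m := by omega
    simp only [e]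
    rw [← h.apply_mod]
    congr 1; omega

end Words

namespace RationalIFS

open Words

variable {E : Type*} (S : RationalIFS E)

lemma sum_den_periodicExtension_rpow [Fintype E] {s : ℝ} (hsum : ∑ a, (S.q a : ℝ) ^ (-s) = 1)
    {j : ℕ} (n : Fin j) :
    ∑ γ : Fin j → E, S.den (periodicExtension γ n) j ^ (-s) = 1 := by
  have h : ∀ γ : Fin j → E, S.den (periodicExtension γ n) j ^ (-s)
      = ∏ i : Fin j, (S.q (γ i) : ℝ) ^ (-s) := by
    intro γ
    rw [den, Finset.prod_range, ← Real.finsetProd_rpow _ _ fun _ _ => Nat.cast_nonneg _]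
    refine Finset.prod_congr rfl fun i _ => ?_
    simp [periodicExtension]
  simp_rw [h]
  have hpow := Fintype.sum_pow (fun a => (S.q a : ℝ) ^ (-s)) j
  rw [hsum, one_pow] at hpow
  exact hpow.symm

variable [Finite E] [TopologicalSpace E] [DiscreteTopology E] [MeasurableSpace E] [BorelSpace E]

/-- Almost every word codes a badly approximable point, by the Borel–Cantelli lemma applied to the
neighbourhoods of all eventually periodic points, one for each preperiod and period. -/
lemma ae_badlySymbApprox_coding (hp : ∀ a, S.p a = 1 ∨ S.p a = -1) {ψ : ℝ → ℝ}
    (hψ_pos : ∀ t : ℝ, 0 < t → 0 < ψ t) (hψ_anti : AntitoneOn ψ (Set.Ioi 0)) {c d : ℝ}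
    (hcd : c ≤ d) (hmap : ∀ a, S.u a '' Icc c d ⊆ Icc c d) {κ : ℝ} (hκ0 : 0 < κ)
    (hκ : ∀ a b, a ≠ b → ∀ x ∈ Icc c d, ∀ y ∈ Icc c d, κ ≤ |S.u a x - S.u b y|)
    (m : Measure E) [IsProbabilityMeasure m] {s : ℝ} (hs : 0 < s)
    (hm : ∀ a, m.real {a} = (S.q a : ℝ) ^ (-s))
    (h : Summable fun n : ℕ => Real.log (n + 1) * ψ (n + 1) ^ s / (n + 1)) :
    ∀ᵐ ω ∂bernoulli m, S.BadlySymbApprox ψ (S.coding ω) := by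
  have := Fintype.ofFinite E
  have hsum : ∑ a, (S.q a : ℝ) ^ (-s) = 1 := by
    simp_rw [← hm]
    rw [sum_measureReal_singleton, Finset.coe_univ, probReal_univ]
  have hser := summable_length_mul_of_summable_log hψ_pos hψ_anti hs h
  let ι : Type _ := Σ j : ℕ, (Fin j → E) × Fin j
  set w : ι → ℕ → E := fun i => periodicExtension i.2.1 i.2.2 with hw
  set D : ι → ℝ := fun i => S.den (w i) i.1 with hD
  set ρ : ι → ℝ := fun i => 2 * ψ (D i / 2) / D i with hρ
  have hD0 : ∀ i, 0 < D i := fun i => S.den_pos hp _ _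
  have hρ0 : ∀ i, 0 < ρ i := fun i => by
    have := hD0 i
    have := hψ_pos (D i / 2) (by positivity)
    positivity
  set B : ι → Set (ℕ → E) := fun i => {ω | |S.coding ω - S.coding (w i)| < ρ i} with hB
  have hBle : ∀ i, (bernoulli m).real (B i)
      ≤ (4 / κ) ^ s * ψ (2 ^ i.1 / 2) ^ s * D i ^ (-s) := by
    intro i
    have h1 : (bernoulli m).real (B i) ≤ (2 * ρ i / κ) ^ s := by
      refine S.bernoulli_real_le_of_abs_coding_sub_le m hm hp hs hcd hmap hκ0 hκ
        (by linarith [hρ0 i]) fun ω hω η hη => ?_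
      have h2 := abs_sub_le (S.coding ω) (S.coding (w i)) (S.coding η)
      rw [abs_sub_comm (S.coding (w i))] at h2
      have h3 : |S.coding ω - S.coding (w i)| < ρ i := hω
      have h4 : |S.coding η - S.coding (w i)| < ρ i := hη
      linarith
    refine h1.trans ?_
    have hDi := hD0 i
    have h2D : (2 : ℝ) ^ i.1 ≤ D i := S.two_pow_le_den hp _ _
    have hψ0 : 0 < ψ (2 ^ i.1 / 2) := hψ_pos _ (by positivity)
    have h5 : ψ (D i / 2) ≤ ψ (2 ^ i.1 / 2) :=
      hψ_anti (show (0 : ℝ) < 2 ^ i.1 / 2 by positivity) (show 0 < D i / 2 by positivity)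
        (by gcongr)
    have hψD : 0 < ψ (D i / 2) := hψ_pos _ (by positivity)
    rw [Real.rpow_neg hDi.le, ← Real.inv_rpow hDi.le, ← Real.mul_rpow (by positivity) hψ0.le,
      ← Real.mul_rpow (by positivity) (by positivity)]
    refine Real.rpow_le_rpow (by have := hρ0 i; positivity) ?_ hs.le
    calc 2 * ρ i / κ = 4 / κ * ψ (D i / 2) * (D i)⁻¹ := by
          simp only [hρ]; field_simp; ring
      _ ≤ 4 / κ * ψ (2 ^ i.1 / 2) * (D i)⁻¹ := by gcongr
  have htsum : ∑' i, bernoulli m (B i) ≠ ⊤ := by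
    rw [ENNReal.tsum_sigma']
    have hj : ∀ j : ℕ, ∑' x : (Fin j → E) × Fin j, bernoulli m (B ⟨j, x⟩)
        ≤ ENNReal.ofReal ((4 / κ) ^ s * (j * ψ (2 ^ j / 2) ^ s)) := by
      intro j
      have hψ0 : 0 < ψ (2 ^ j / 2) := hψ_pos _ (by positivity)
      rw [tsum_fintype]
      calc ∑ x : (Fin j → E) × Fin j, bernoulli m (B ⟨j, x⟩)
          ≤ ∑ x : (Fin j → E) × Fin j, ENNReal.ofReal ((4 / κ) ^ s * ψ (2 ^ j / 2) ^ s
              * D ⟨j, x⟩ ^ (-s)) := by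
            refine Finset.sum_le_sum fun x _ => ?_
            rw [← ofReal_measureReal (measure_ne_top _ _)]
            exact ENNReal.ofReal_le_ofReal (hBle ⟨j, x⟩)
        _ = ENNReal.ofReal (∑ x : (Fin j → E) × Fin j, (4 / κ) ^ s * ψ (2 ^ j / 2) ^ s
              * D ⟨j, x⟩ ^ (-s)) :=
            (ENNReal.ofReal_sum_of_nonneg fun x _ => by
              have := hD0 ⟨j, x⟩
              positivity).symm
        _ = _ := by
            congr 1
            rw [← Finset.mul_sum, Fintype.sum_prod_type_right]
            have : ∀ n : Fin j, ∑ γ : Fin j → E, D ⟨j, (γ, n)⟩ ^ (-s) = 1 := fun n =>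
              S.sum_den_periodicExtension_rpow hsum n
            rw [Finset.sum_congr rfl fun n _ => this n]
            simp only [Finset.sum_const, Finset.card_univ, Fintype.card_fin, nsmul_eq_mul, mul_one]
            ring
    exact ne_top_of_le_ne_top (hser.mul_left ((4 / κ) ^ s)).tsum_ofReal_ne_top
      (ENNReal.tsum_le_tsum hj)
  have hne : ∀ᵐ ω ∂bernoulli m, ∀ i, S.coding ω ≠ S.coding (w i) := by
    have : Countable ι := inferInstanceAs (Countable (Σ j : ℕ, (Fin j → E) × Fin j))
    rw [ae_all_iff]
    intro i
    rw [ae_iff, ← measureReal_eq_zero_iff]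
    refine le_antisymm ?_ measureReal_nonneg
    have h1 := S.bernoulli_real_le_of_abs_coding_sub_le m hm hp hs hcd hmap hκ0 hκ le_rfl
      (V := {ω | ¬ S.coding ω ≠ S.coding (w i)}) fun ω hω η hη => by
        rw [not_not.1 hω, not_not.1 hη, sub_self, abs_zero]
    rwa [zero_div, Real.zero_rpow hs.ne'] at h1
  filter_upwards [ae_finite_setOfPred_mem htsum, hne] with ω hfin hω
  refine ⟨mem_range_self ω, ?_⟩
  -- Only finitely many neighbourhoods contain the point, and it is the centre of none.
  obtain ⟨ε, hε, hεle⟩ : ∃ ε : ℝ, 0 < ε ∧ ∀ i, ε * ρ i ≤ |S.coding ω - S.coding (w i)| := by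
    have hδ : ∀ i, 0 < |S.coding ω - S.coding (w i)| / ρ i := fun i =>
      div_pos (abs_pos.2 (sub_ne_zero.2 (hω i))) (hρ0 i)
    have hout : ∀ i, i ∉ hfin.toFinset → ρ i ≤ |S.coding ω - S.coding (w i)| := fun i hi => by
      rw [Finite.mem_toFinset] at hi
      exact not_lt.1 hi
    rcases hfin.toFinset.eq_empty_or_nonempty with h0 | h0
    · exact ⟨1, one_pos, fun i => by rw [one_mul]; exact hout i (by rw [h0]; simp)⟩
    · obtain ⟨i₀, -, hmin⟩ := Finset.exists_min_image hfin.toFinset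
        (fun i => |S.coding ω - S.coding (w i)| / ρ i) h0
      refine ⟨min 1 (|S.coding ω - S.coding (w i₀)| / ρ i₀), lt_min one_pos (hδ i₀), fun i => ?_⟩
      by_cases hi : i ∈ hfin.toFinset
      · rw [← le_div_iff₀ (hρ0 i)]
        exact (min_le_right _ _).trans (hmin i hi)
      · refine le_trans ?_ (hout i hi)
        exact mul_le_of_le_one_left (hρ0 i).le (min_le_left _ _)
  refine ⟨ε, hε, ?_⟩
  rintro y - N ⟨η, hep, hηy, rfl⟩
  have hper := hep.isPeriodFrom
  set i : ι := ⟨preperiod η + minPeriod η, fun i => η i,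
    ⟨preperiod η, Nat.lt_add_of_pos_right hper.1⟩⟩ with hi
  have hwi : w i = η := periodicExtension_of_isPeriodFrom hper
  have hDi : D i = S.den η (preperiod η + minPeriod η) := by rw [hD]; simp only [hwi]; rfl
  refine le_trans ?_ ((hεle i).trans_eq (by rw [hwi, hηy]))
  have hN := S.le_intDenomWord hp hep
  rw [← hDi] at hN
  have hD2 : 0 < D i / 2 := half_pos (hD0 i)
  have hN0 : (0 : ℝ) < S.intDenomWord η := hD2.trans_le hN
  have h1 : ψ (S.intDenomWord η) ≤ ψ (D i / 2) := hψ_anti hD2 hN0 hN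
  have h2 : ρ i = ψ (D i / 2) / (D i / 2) := by
    have := (hD0 i).ne'
    simp only [hρ]; field_simp
  rw [h2]
  have := hψ_pos _ hD2
  gcongr

end RationalIFS

/-! ### Systems with at most one map, and the conclusion -/

lemma not_summable_log_div : ¬ Summable fun n : ℕ => Real.log (n + 1) / (n + 1) := by
  intro h
  refine Real.not_summable_one_div_natCast ((summable_nat_add_iff 3).1 ?_)
  refine Summable.of_nonneg_of_le (fun n => by positivity) (fun n => ?_)
    ((summable_nat_add_iff 2).2 h)
  have h1 : (1 : ℝ) ≤ Real.log ((n : ℝ) + 3) := by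
    rw [Real.le_log_iff_exp_le (by positivity)]
    have := Real.exp_one_lt_d9
    have : (0 : ℝ) ≤ n := Nat.cast_nonneg n
    linarith
  have e : ((n + 2 : ℕ) : ℝ) + 1 = n + 3 := by push_cast; ring
  rw [e]
  push_cast
  gcongr

namespace RationalIFS

open Words

variable {E : Type*} (S : RationalIFS E)

lemma subsingleton_limitSet [Subsingleton E] : S.limitSet.Subsingleton := by
  rintro _ ⟨ω, rfl⟩ _ ⟨η, rfl⟩
  rw [Subsingleton.elim ω η]

lemma dim_eq_zero_of_subsingleton [Subsingleton E] : S.dim = 0 := by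
  rw [dim, dimH_subsingleton S.subsingleton_limitSet, ENNReal.toReal_zero]

lemma ae_wellSymbApprox_of_subsingleton [Finite E] [Subsingleton E]
    (hp : ∀ a, S.p a = 1 ∨ S.p a = -1) {ψ : ℝ → ℝ} (hψ_pos : ∀ t : ℝ, 0 < t → 0 < ψ t)
    (hψ_anti : AntitoneOn ψ (Set.Ioi 0)) (hψ_slow : SlowlyVarying ψ) :
    ∀ᵐ x ∂S.measure, S.WellSymbApprox ψ x := by
  refine Measure.ae_smul_measure ?_ _
  have hJ : MeasurableSet S.limitSet := S.subsingleton_limitSet.measurableSet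
  filter_upwards [ae_restrict_mem hJ] with x hx
  obtain ⟨ω, rfl⟩ := hx
  refine S.wellSymbApprox_of_mem hp hψ_pos hψ_anti hψ_slow (mem_iInter.2 fun i => ?_)
  refine ⟨ω, 0, 1, ⟨one_pos, fun i => Subsingleton.elim _ _⟩, ?_⟩
  have hD := S.den_pos hp ω (0 + 1)
  have := hψ_pos _ hD
  rw [sub_self, abs_zero]
  positivity

end RationalIFS

theorem mainTheorem2 {E : Type*} [Finite E] (S : RationalIFS E)
    (hp : ∀ a, S.p a = 1 ∨ S.p a = -1) (hS : S.StrongSeparation)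
    (ψ : ℝ → ℝ) (hψ_pos : ∀ t : ℝ, 0 < t → 0 < ψ t)
    (hψ_anti : AntitoneOn ψ (Set.Ioi 0))
    (hψ_slow : SlowlyVarying ψ)
    (hψ_bdd : ∃ M : ℝ, ∀ t : ℝ, 0 < t → ψ t ≤ M) :
    (Summable (fun n : ℕ => Real.log (n + 1) * ψ (n + 1) ^ S.dim / (n + 1)) →
      ∀ᵐ x ∂S.measure, S.BadlySymbApprox ψ x) ∧
    (¬ Summable (fun n : ℕ =>
        Real.log (n + 1) * ψ (n + 1) ^ S.dim / ((n + 1) * Real.log (ψ (n + 1)))) →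
      ∀ᵐ x ∂S.measure, S.WellSymbApprox ψ x) := by
  rcases subsingleton_or_nontrivial E with hE | hE
  · refine ⟨fun h => absurd ?_ not_summable_log_div,
      fun _ => S.ae_wellSymbApprox_of_subsingleton hp hψ_pos hψ_anti hψ_slow⟩
    simpa [S.dim_eq_zero_of_subsingleton] using h
  · have := Fintype.ofFinite E
    let : TopologicalSpace E := ⊥
    let : MeasurableSpace E := ⊤
    have : DiscreteTopology E := ⟨rfl⟩
    have : BorelSpace E := ⟨borel_eq_top_of_discrete.symm⟩
    obtain ⟨c, d, hcd, hmap, hdisj⟩ := hS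
    obtain ⟨s, hs, hsum⟩ := S.exists_sum_rpow_eq_one hp
    obtain ⟨m, hmp, hm⟩ := S.exists_letter_law hsum
    obtain ⟨κ, hκ0, hκ⟩ := S.exists_gap hdisj
    have hdim : S.dim = s := S.dim_eq m hm hp hs hcd.le hmap hκ0 hκ
    rw [hdim]
    refine ⟨fun h => ?_, fun h => ?_⟩
    · exact S.ae_measure_of_ae_bernoulli m hm hp hs hcd.le hmap hdim
        (S.ae_badlySymbApprox_coding hp hψ_pos hψ_anti hcd.le hmap hκ0 hκ m hs hm h)
    · refine S.ae_measure_of_ae_bernoulli m hm hp hs hcd.le hmap hdim ?_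
      filter_upwards [S.ae_mem_wellApproxWords hp hψ_pos hψ_anti hψ_slow hcd.le hmap m hs hm h]
        with ω hω
      exact S.wellSymbApprox_of_mem hp hψ_pos hψ_anti hψ_slow hω
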